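/- **Proposition (asymptotics of the scattering matrix).** Let $\alpha>0$, $u_0>0$, $u_\pm\in\mathbb C$ with $|u_\pm|=u_0$, and fix a time $t$. Let $u(\cdot,t):\mathbb R\to\mathbb C$ be continuously differentiable with $u(x,t)\to u_\pm$ as $x\to\pm\infty$, $u(\cdot,t)-u_-\in L^1(-\infty,0)$, $u(\cdot,t)-u_+\in L^1(0,\infty)$ and $u_x(\cdot,t)\in L^1(\mathbb R)$ (for example, $u(\cdot,t)$ may be the profile at time $t$ of a solution of the modified NLS equation $iu_t+u_{xx}+4i\alpha u_x+\frac{i}{\alpha}(|u|^2u)_x=0$). For $z\ne0$ put $k=\frac1{2\alpha}\left(z-\frac{u_0^2}{z}\right)$, $\lambda=\frac12\left(z+\frac{u_0^2}{z}\right)$, $\theta=-k\lambda\left[x+\left(2\alpha k^2-4\alpha-\frac{u_0^2}{\alpha}\right)t\right]$, $\gamma=1+\frac{u_0^2}{z^2}$, and $$\sigma_3=\begin{pmatrix}1&0\\0&-1\end{pmatrix},\quad Q=\begin{pmatrix}0&u\\ u^*&0\end{pmatrix},\quad Q_\pm=\begin{pmatrix}0&u_\pm\\ u_\pm^*&0\end{pmatrix},\quad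 X=-i\alpha k^2\sigma_3+ikQ,\quad Y_\pm=I+\frac1z\sigma_3Q_\pm .$$ Let $\Sigma=(\mathbb R\cup i\mathbb R)\setminus\{0\}$, $D^+=\{\operatorname{Re}z\operatorname{Im}z<0\}$, $D^-=\{\operatorname{Re}z\operatorname{Im}z>0\}$. The Jost solutions $\phi_\pm=(\phi_{\pm,1},\phi_{\pm,2})$ are the solutions of $\phi_x=X\phi$ with $\phi_\pm e^{-i\theta\sigma_3}\to Y_\pm$ as $x\to\pm\infty$. Away from $z=\pm iu_0$, both columns exist for $z\in\Sigma$, while $\phi_{+,1},\phi_{-,2}$ exist for $z\in D^+\cup\Sigma$ and $\phi_{-,1},\phi_{+,2}$ for $z\in D^-\cup\Sigma$. The scattering matrix $S(z)=(s_{ij}(z))$ is defined for $z\in\Sigma\setminus\{\pm iu_0\}$ by $\phi_+=\phi_-S(z)$ for all $x\in\mathbb R$. For all $x$ and all such $z$ its diagonal entries are $$s_{11}=\frac{\det(\phi_{+,1},\phi_{-,2})}{\gamma},\qquad s_{22}=\frac{\det(\phi_{-,1},\phi_{+,2})}{\gamma},$$ and these formulas define $s_{11}$ on $D^+\cup\Sigma$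 and $s_{22}$ on $D^-\cup\Sigma$ (except at $\pm iu_0$). Then $u_0^2-|u(\cdot,t)|^2$ is integrable on $\mathbb R$ and, with $$\nu_0=\frac1{2\alpha}\int_{-\infty}^{+\infty}\left(u_0^2-|u(y,t)|^2\right)dy,$$ one has, for $z\in\Sigma$, $$S(z)=e^{-i\nu_0\sigma_3}+O(z^{-1})\quad(z\to\infty),\qquad S(z)=\operatorname{diag}\left(\frac{u_-}{u_+},\frac{u_+}{u_-}\right)e^{i\nu_0\sigma_3}+O(z)\quad(z\to0).$$ Moreover the resulting asymptotics of the diagonal entries hold in the full regions: $s_{11}(z)=e^{-i\nu_0}+O(z^{-1})$ as $z\to\infty$ and $s_{11}(z)=\frac{u_-}{u_+}e^{i\nu_0}+O(z)$ as $z\to0$, for $z\in D^+\cup\Sigma$; and $s_{22}(z)=e^{i\nu_0}+O(z^{-1})$ as $z\to\infty$ and $s_{22}(z)=\frac{u_+}{u_-}e^{-i\nu_0}+O(z)$ as $z\to0$, for $z\in D^-\cup\Sigma$. -/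

import Mathlib

open Complex Filter Topology MeasureTheory Matrix

namespace MNLS

/-- `k(z) = (z - u₀² / z) / (2α)`. -/
noncomputable def specK (α u₀ : ℝ) (z : ℂ) : ℂ := (z - (u₀ : ℂ) ^ 2 / z) / (2 * (α : ℂ))

/-- `λ(z) = (z + u₀² / z) / 2`. -/
noncomputable def specLam (u₀ : ℝ) (z : ℂ) : ℂ := (z + (u₀ : ℂ) ^ 2 / z) / 2

/-- The phase `θ(x,t,z) = -k λ (x + (2 α k² - 4 α - u₀² / α) t)`. -/
noncomputable def phase (α u₀ x t : ℝ) (z : ℂ) : ℂ :=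
  -(specK α u₀ z * specLam u₀ z *
    ((x : ℂ) + (2 * (α : ℂ) * specK α u₀ z ^ 2 - 4 * (α : ℂ) - (u₀ : ℂ) ^ 2 / (α : ℂ)) * (t : ℂ)))

/-- The Pauli matrix `σ₃`. -/
def sigma3 : Matrix (Fin 2) (Fin 2) ℂ := !![1, 0; 0, -1]

/-- The matrix exponential `e^{a σ₃} = diag(e^a, e^{-a})`. -/
noncomputable def expSigma3 (a : ℂ) : Matrix (Fin 2) (Fin 2) ℂ := !![exp a, 0; 0, exp (-a)]

/-- The off-diagonal matrix `Q` built from the value `w` of the potential. -/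
noncomputable def potQ (w : ℂ) : Matrix (Fin 2) (Fin 2) ℂ := !![0, w; starRingEnd ℂ w, 0]

/-- The matrix `X = -i α k² σ₃ + i k Q` of the spatial part of the Lax pair, at a point where the
potential has the value `w`. -/
noncomputable def laxX (α u₀ : ℝ) (z w : ℂ) : Matrix (Fin 2) (Fin 2) ℂ :=
  (-(I * (α : ℂ) * specK α u₀ z ^ 2)) • sigma3 + (I * specK α u₀ z) • potQ w

/-- The eigenvector matrix `Y = I + z⁻¹ σ₃ Q` of `X` at a boundary value `v` of the potential. -/
noncomputable def eigY (z v : ℂ) : Matrix (Fin 2) (Fin 2) ℂ := 1 + z⁻¹ • (sigma3 * potQ v)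

/-- `γ(z) = det Y = 1 + u₀² / z²`. -/
noncomputable def gam (u₀ : ℝ) (z : ℂ) : ℂ := 1 + (u₀ : ℂ) ^ 2 / z ^ 2

/-- The contour `Σ = (ℝ ∪ iℝ) \ {0}`. -/
def contour : Set ℂ := {z | z.re * z.im = 0 ∧ z ≠ 0}

/-- The open region `D⁺`. -/
def Dplus : Set ℂ := {z | z.re * z.im < 0}

/-- The open region `D⁻`. -/
def Dminus : Set ℂ := {z | 0 < z.re * z.im}

/-- `φ` is, at time `t`, the `j`-th column of the Jost solution `φ ∼ Y e^{iθσ₃}` normalised at the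
end `l` of the line (`atTop` or `atBot`), where the potential has the boundary value `v`: it solves
`φ_x = X φ`, and the `j`-th column of `φ e^{-iθσ₃}` tends to that of `Y`. -/
def IsJostColumn (l : Filter ℝ) (v : ℂ) (α u₀ : ℝ) (u : ℝ → ℝ → ℂ) (j : Fin 2) (t : ℝ) (z : ℂ)
    (φ : ℝ → Fin 2 → ℂ) : Prop :=
  (∀ x, HasDerivAt φ (laxX α u₀ z (u x t) *ᵥ φ x) x) ∧
    Tendsto (fun x => expSigma3 (-(I * phase α u₀ x t z)) j j • φ x) l
      (𝓝 (fun i => eigY z v i j))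

open Classical in
/-- The `j`-th Jost column (the zero function if there is none). -/
noncomputable def jostColumn (l : Filter ℝ) (v : ℂ) (α u₀ : ℝ) (u : ℝ → ℝ → ℂ) (j : Fin 2)
    (x t : ℝ) (z : ℂ) : Fin 2 → ℂ :=
  if h : ∃ φ, IsJostColumn l v α u₀ u j t z φ then h.choose x else 0

/-- The Jost solution `φ₊ = (φ₊,₁, φ₊,₂)` if `(l, v) = (atTop, u₊)`, and
`φ₋ = (φ₋,₁, φ₋,₂)` if `(l, v) = (atBot, u₋)`. -/
noncomputable def jost (l : Filter ℝ) (v : ℂ) (α u₀ : ℝ) (u : ℝ → ℝ → ℂ) (x t : ℝ) (z : ℂ) :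
    Matrix (Fin 2) (Fin 2) ℂ :=
  Matrix.of fun i j => jostColumn l v α u₀ u j x t z i

open Classical in
/-- The scattering matrix: the matrix `S` with `φ₊ = φ₋ S` on the whole line (zero if there is
none). -/
noncomputable def scatteringMatrix (α u₀ : ℝ) (um up : ℂ) (u : ℝ → ℝ → ℂ) (t : ℝ) (z : ℂ) :
    Matrix (Fin 2) (Fin 2) ℂ :=
  if h : ∃ S : Matrix (Fin 2) (Fin 2) ℂ,
      ∀ x, jost atTop up α u₀ u x t z = jost atBot um α u₀ u x t z * S
  then h.choose else 0

/-- The Wronskian of two vectors. -/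
def wronskian (a b : Fin 2 → ℂ) : ℂ := a 0 * b 1 - a 1 * b 0

/-- The entry `s₁₁ = Wr(φ₊,₁, φ₋,₂) / γ`, on `D⁺` and its boundary `Σ`. The Wronskian of two
solutions does not depend on the point `x`, since `X` has trace zero. -/
noncomputable def s11 (α u₀ : ℝ) (um up : ℂ) (u : ℝ → ℝ → ℂ) (x t : ℝ) (z : ℂ) : ℂ :=
  wronskian (jostColumn atTop up α u₀ u 0 x t z) (jostColumn atBot um α u₀ u 1 x t z) / gam u₀ z

/-- The entry `s₂₂ = Wr(φ₋,₁, φ₊,₂) / γ`, on `D⁻` and its boundary `Σ`. -/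
noncomputable def s22 (α u₀ : ℝ) (um up : ℂ) (u : ℝ → ℝ → ℂ) (x t : ℝ) (z : ℂ) : ℂ :=
  wronskian (jostColumn atBot um α u₀ u 0 x t z) (jostColumn atTop up α u₀ u 1 x t z) / gam u₀ z

/-- `ν₀ = (1 / 2α) ∫ (u₀² - |u|²) dy`. -/
noncomputable def nu0 (α u₀ : ℝ) (u : ℝ → ℝ → ℂ) (t : ℝ) : ℝ :=
  1 / (2 * α) * ∫ y : ℝ, (u₀ ^ 2 - ‖u y t‖ ^ 2)

end MNLS

/-!
For a potential of constant modulus `u₀`, the matrix `X` has eigenvalues `±ikλ` and the columns of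
`Y` as eigenvectors. Diagonalizing `X` at each `x` with the actual potential `u(x, t)` in place of
its boundary value, and removing the phase, turns the equation for `φ₊,₁` into
`w' = (diag(0, 2ikλ) + diag(q, -q) + V) w` with `q = i(u₀² - |u|²) / 2α` and `V` integrable in `x`
and of size `O(1/z)` as `z → ∞`. The term `diag(q, -q)` does not become small for large `z`; it is
removed by the factor `exp(i tailPhase σ₃)`. Since `Re(2ikλ) ≥ 0` on `D⁺ ∪ Σ`, the solutions of
what remains that tend to `(1, 0)` are given by a Volterra equation on `[x, ∞)`, and stay within
`O(1/z)` of `(1, 0)`. So `φ₊,₁` tends, apart from its phase, to `(exp(-i tailPhase), 0)`.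

The symmetries `z ↦ -z̄` and `(x, t) ↦ (-x, -t)` give the other three Jost columns. In the
Wronskians the tail phases of the two half-lines add up to `ν₀`. The symmetry `z ↦ -u₀²/z` fixes
`k`, changes the sign of `λ` and interchanges the columns up to scalar factors, hence carries the
asymptotics at infinity to the origin, where the scalar factors produce `u₋/u₊` and `u₊/u₋`.
-/

namespace MNLS

open scoped BoundedContinuousFunction

/-! ### Integrals over half-lines -/

section HalfLine

variable {E : Type*} [NormedAddCommGroup E] [NormedSpace ℝ E] [CompleteSpace E]

theorem hasDerivAt_integral_Ioi {f : ℝ → E} (hf : Continuous f)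
    (hint : ∀ a, IntegrableOn f (Set.Ioi a)) (x : ℝ) :
    HasDerivAt (fun x => ∫ y in Set.Ioi x, f y) (-f x) x := by
  have hsplit : (fun x => ∫ y in Set.Ioi x, f y)
      = fun x => (∫ y in Set.Ioi (0 : ℝ), f y) - ∫ y in (0 : ℝ)..x, f y := by
    funext x
    rw [eq_sub_iff_add_eq, add_comm]
    exact intervalIntegral.integral_interval_add_Ioi (hint 0) (hint x)
  rw [hsplit]
  simpa only [zero_sub] using (hf.integral_hasStrictDerivAt 0 x).hasDerivAt.const_sub _

theorem norm_sub_le_integral_Ioi {c c' : ℝ → E} {β : ℝ → ℝ} {l : E} {y : ℝ}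
    (hβ : IntegrableOn β (Set.Ioi y)) (hc : ∀ x, HasDerivAt c (c' x) x)
    (hlim : Tendsto c atTop (𝓝 l)) (hbound : ∀ s, y < s → ‖c' s‖ ≤ β s) :
    ‖c y - l‖ ≤ ∫ s in Set.Ioi y, β s := by
  have hbound' : ∀ᵐ s ∂volume.restrict (Set.Ioi y), ‖c' s‖ ≤ β s := by
    filter_upwards [ae_restrict_mem measurableSet_Ioi] with s hs using hbound s hs
  have hderiv : c' = deriv c := funext fun x => (hc x).deriv.symm
  have hint : IntegrableOn c' (Set.Ioi y) :=
    Integrable.mono' hβ (hderiv ▸ aestronglyMeasurable_deriv c _) hbound'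
  rw [norm_sub_rev, ← integral_Ioi_of_hasDerivAt_of_tendsto' (fun x _ => hc x) hint hlim]
  exact norm_integral_le_of_norm_le hβ hbound'

end HalfLine

theorem bddAbove_norm_image_Ici {E : Type*} [SeminormedAddCommGroup E] {f : ℝ → E} {l : E}
    (hf : Continuous f) (hl : Tendsto f atTop (𝓝 l)) (x : ℝ) :
    BddAbove ((fun y => ‖f y‖) '' Set.Ici x) := by
  obtain ⟨N, hN⟩ := eventually_atTop.1 (hl.norm.eventually (gt_mem_nhds (lt_add_one ‖l‖)))
  have hcompact : BddAbove ((fun y => ‖f y‖) '' Set.Icc x N) :=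
    isCompact_Icc.bddAbove_image hf.norm.continuousOn
  refine (hcompact.union (t := (fun y => ‖f y‖) '' Set.Ici N)
    ⟨‖l‖ + 1, Set.forall_mem_image.2 fun y hy => (hN y hy).le⟩).mono ?_
  rw [← Set.image_union]
  exact Set.image_mono fun y hy => (le_total y N).imp (fun h => ⟨hy, h⟩) id

/-! ### Linear systems that are diagonal up to an integrable perturbation -/

/-- The linear system `w' = (diag m + V) w` on the line is a perturbation, integrable at `+∞`, of a
diagonal system none of whose solutions decays at `+∞`; `β` bounds the size of `V`. -/
structure IsIntegrablePerturbation {ι : Type*} [Fintype ι] (m : ι → ℂ) (V : ℝ → Matrix ι ι ℂ)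
    (β : ℝ → ℝ) : Prop where
  re_nonneg : ∀ i, 0 ≤ (m i).re
  continuous_coeff : Continuous V
  continuous_bound : Continuous β
  bound_nonneg : ∀ x, 0 ≤ β x
  integrableOn_bound : ∀ a, IntegrableOn β (Set.Ioi a)
  norm_mulVec_le : ∀ x w, ‖V x *ᵥ w‖ ≤ β x * ‖w‖

section Weight

/-- The weight `exp (2 ∫ₓ^∞ β)`: in the supremum norm with this weight the Volterra operator of a
system with perturbation bounded by `β` has norm at most `1 / 2`. -/
noncomputable def weight (β : ℝ → ℝ) (x : ℝ) : ℝ := Real.exp (2 * ∫ y in Set.Ioi x, β y)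

variable {β : ℝ → ℝ}

theorem weight_pos (x : ℝ) : 0 < weight β x := Real.exp_pos _

theorem one_le_weight (hβ0 : ∀ x, 0 ≤ β x) (x : ℝ) : 1 ≤ weight β x :=
  Real.one_le_exp (mul_nonneg zero_le_two (integral_nonneg hβ0))

theorem hasDerivAt_weight (hβc : Continuous β) (hβ : ∀ a, IntegrableOn β (Set.Ioi a)) (x : ℝ) :
    HasDerivAt (weight β) (-2 * (β x * weight β x)) x := by
  refine ((hasDerivAt_integral_Ioi hβc hβ x).const_mul 2).exp.congr_deriv ?_
  rw [weight]
  ring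

theorem continuous_weight (hβc : Continuous β) (hβ : ∀ a, IntegrableOn β (Set.Ioi a)) :
    Continuous (weight β) :=
  continuous_iff_continuousAt.2 fun x => (hasDerivAt_weight hβc hβ x).continuousAt

theorem antitone_weight (hβ : ∀ a, IntegrableOn β (Set.Ioi a)) (hβ0 : ∀ x, 0 ≤ β x) :
    Antitone (weight β) := fun a _ hab =>
  Real.exp_le_exp.2 (mul_le_mul_of_nonneg_left (setIntegral_mono_set (hβ a)
    (Eventually.of_forall hβ0) (Set.Ioi_subset_Ioi hab).eventuallyLE) zero_le_two)

theorem tendsto_weight : Tendsto (weight β) atTop (𝓝 1) := by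
  have h : Tendsto (fun x => ∫ y in Set.Ioi x, β y) atTop (𝓝 0) :=
    tendsto_integral_Ioi_zero tendsto_id
  have hexp := (h.const_mul 2).rexp
  rwa [mul_zero, Real.exp_zero] at hexp

theorem integrableOn_mul_weight (hβc : Continuous β) (hβ : ∀ a, IntegrableOn β (Set.Ioi a))
    (hβ0 : ∀ x, 0 ≤ β x) (a : ℝ) : IntegrableOn (fun s => β s * weight β s) (Set.Ioi a) := by
  refine Integrable.mono' ((hβ a).mul_const (weight β a))
    (hβc.mul (continuous_weight hβc hβ)).aestronglyMeasurable ?_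
  filter_upwards [ae_restrict_mem measurableSet_Ioi] with s hs
  rw [Real.norm_of_nonneg (mul_nonneg (hβ0 s) (weight_pos s).le)]
  exact mul_le_mul_of_nonneg_left (antitone_weight hβ hβ0 (le_of_lt hs)) (hβ0 s)

theorem integral_Ioi_mul_weight (hβc : Continuous β) (hβ : ∀ a, IntegrableOn β (Set.Ioi a))
    (hβ0 : ∀ x, 0 ≤ β x) (x : ℝ) :
    ∫ s in Set.Ioi x, β s * weight β s = (weight β x - 1) / 2 := by
  have h := integral_Ioi_of_hasDerivAt_of_tendsto'
    (fun s (_ : s ∈ Set.Ici x) => hasDerivAt_weight hβc hβ s)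
    ((integrableOn_mul_weight hβc hβ hβ0 x).const_mul (-2)) tendsto_weight
  rw [integral_const_mul] at h
  linarith

end Weight

theorem norm_exp_mul_sub_le_one {μ : ℂ} (hμ : 0 ≤ μ.re) {x y : ℝ} (hxy : x ≤ y) :
    ‖exp (μ * (x - y))‖ ≤ 1 := by
  rw [norm_exp, Real.exp_le_one_iff, ← ofReal_sub, re_mul_ofReal]
  exact mul_nonpos_of_nonneg_of_nonpos hμ (sub_nonpos.2 hxy)

section Perturbation

variable {ι : Type*} [Fintype ι] {m : ι → ℂ} {V : ℝ → Matrix ι ι ℂ} {β : ℝ → ℝ}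
  {w w' : ℝ → ι → ℂ} {e : ι → ℂ} {K K' : ℝ}

/-- The Volterra operator of the system `w' = (diag m + V) w`: a bounded solution of
`w = e - volterra m V w` with `m * e = 0` is a solution of the system that tends to `e`. -/
noncomputable def volterra (m : ι → ℂ) (V : ℝ → Matrix ι ι ℂ) (w : ℝ → ι → ℂ) (x : ℝ) : ι → ℂ :=
  fun i => ∫ y in Set.Ioi x, exp (m i * (x - y)) * (V y *ᵥ w y) i

namespace IsIntegrablePerturbation

theorem norm_kernel_le (h : IsIntegrablePerturbation m V β) {x y : ℝ} (hxy : x ≤ y) (i : ι)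
    (v : ι → ℂ) : ‖exp (m i * (x - y)) * (V y *ᵥ v) i‖ ≤ β y * ‖v‖ := by
  rw [norm_mul]
  exact (mul_le_of_le_one_left (norm_nonneg _)
    (norm_exp_mul_sub_le_one (h.re_nonneg i) hxy)).trans
    ((norm_le_pi_norm _ i).trans (h.norm_mulVec_le y v))

theorem norm_kernel_le_weight (h : IsIntegrablePerturbation m V β)
    (hwK : ∀ x, ‖w x‖ ≤ K * weight β x) {x y : ℝ} (hxy : x ≤ y) (i : ι) :
    ‖exp (m i * (x - y)) * (V y *ᵥ w y) i‖ ≤ K * (β y * weight β y) :=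
  (h.norm_kernel_le hxy i _).trans <|
    (mul_le_mul_of_nonneg_left (hwK y) (h.bound_nonneg y)).trans_eq (mul_left_comm _ _ _)

theorem integrableOn_const_mul_weight (h : IsIntegrablePerturbation m V β) (K a : ℝ) :
    IntegrableOn (fun s => K * (β s * weight β s)) (Set.Ioi a) :=
  (integrableOn_mul_weight h.continuous_bound h.integrableOn_bound h.bound_nonneg a).const_mul K

theorem integrableOn_kernel (h : IsIntegrablePerturbation m V β) (hw : Continuous w)
    (hwK : ∀ x, ‖w x‖ ≤ K * weight β x) (x : ℝ) (i : ι) :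
    IntegrableOn (fun y : ℝ => exp (m i * (x - y)) * (V y *ᵥ w y) i) (Set.Ioi x) := by
  have hVw : Continuous fun y => V y *ᵥ w y := h.continuous_coeff.matrix_mulVec hw
  refine Integrable.mono' (h.integrableOn_const_mul_weight K x)
    (Continuous.aestronglyMeasurable (by fun_prop)) ?_
  filter_upwards [ae_restrict_mem measurableSet_Ioi] with s hs
    using h.norm_kernel_le_weight hwK (le_of_lt hs) i

theorem norm_volterra_le (h : IsIntegrablePerturbation m V β) (hK : 0 ≤ K)
    (hwK : ∀ x, ‖w x‖ ≤ K * weight β x) (x : ℝ) :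
    ‖volterra m V w x‖ ≤ K * ((weight β x - 1) / 2) := by
  have hnonneg : 0 ≤ K * ((weight β x - 1) / 2) :=
    mul_nonneg hK (div_nonneg (sub_nonneg.2 (one_le_weight h.bound_nonneg x)) zero_le_two)
  refine (pi_norm_le_iff_of_nonneg hnonneg).2 fun i => ?_
  rw [← integral_Ioi_mul_weight h.continuous_bound h.integrableOn_bound h.bound_nonneg,
    ← integral_const_mul]
  refine norm_integral_le_of_norm_le (h.integrableOn_const_mul_weight K x) ?_
  filter_upwards [ae_restrict_mem measurableSet_Ioi] with s hs
    using h.norm_kernel_le_weight hwK (le_of_lt hs) i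

theorem volterra_add (h : IsIntegrablePerturbation m V β) (hw : Continuous w)
    (hw' : Continuous w') (hwK : ∀ x, ‖w x‖ ≤ K * weight β x)
    (hwK' : ∀ x, ‖w' x‖ ≤ K' * weight β x) (x : ℝ) :
    volterra m V (fun y => w y + w' y) x = volterra m V w x + volterra m V w' x := by
  funext i
  simp only [volterra, mulVec_add, Pi.add_apply, mul_add]
  exact integral_add (h.integrableOn_kernel hw hwK x i) (h.integrableOn_kernel hw' hwK' x i)

end IsIntegrablePerturbation

theorem volterra_const_smul (c : ℂ) (x : ℝ) :
    volterra m V (fun y => c • w y) x = c • volterra m V w x := by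
  funext i
  simp only [volterra, mulVec_smul, Pi.smul_apply, smul_eq_mul, mul_left_comm _ c,
    integral_const_mul]

theorem exp_mul_sub (μ : ℂ) (x y : ℝ) :
    exp (μ * (x - y)) = exp (μ * x) * exp (μ * (0 - y)) := by
  rw [← exp_add]
  ring_nf

namespace IsIntegrablePerturbation

theorem hasDerivAt_volterra (h : IsIntegrablePerturbation m V β) (hw : Continuous w)
    (hwK : ∀ x, ‖w x‖ ≤ K * weight β x) (x : ℝ) :
    HasDerivAt (volterra m V w) (m * volterra m V w x - V x *ᵥ w x) x := by
  refine hasDerivAt_pi.2 fun i => ?_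
  have hfactor : (fun x => volterra m V w x i) = fun x : ℝ =>
      exp (m i * x) * ∫ y in Set.Ioi x, exp (m i * (0 - y)) * (V y *ᵥ w y) i := by
    funext x
    simp only [volterra, exp_mul_sub _ x, mul_assoc, integral_const_mul]
  have hint (a : ℝ) :
      IntegrableOn (fun y : ℝ => exp (m i * (0 - y)) * (V y *ᵥ w y) i) (Set.Ioi a) := by
    refine ((h.integrableOn_kernel hw hwK a i).const_mul (exp (-(m i * a)))).congr
      (Eventually.of_forall fun y => ?_)
    beta_reduce
    rw [exp_mul_sub _ a, ← mul_assoc, ← mul_assoc, ← exp_add, neg_add_cancel, exp_zero, one_mul]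
  have hVw : Continuous fun y => V y *ᵥ w y := h.continuous_coeff.matrix_mulVec hw
  have hexp : HasDerivAt (fun x : ℝ => m i * (x : ℂ)) (m i * 1) x :=
    (hasDerivAt_id x).ofReal_comp.const_mul (m i)
  rw [hfactor]
  refine (hexp.cexp.mul (hasDerivAt_integral_Ioi (by fun_prop) hint x)).congr_deriv ?_
  have hcancel : exp (m i * x) * exp (m i * (0 - x)) = 1 := by
    rw [← exp_mul_sub, sub_self, mul_zero, exp_zero]
  simp only [Pi.sub_apply, Pi.mul_apply, congr_fun hfactor x]
  linear_combination -(V x *ᵥ w x) i * hcancel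

theorem continuous_volterra (h : IsIntegrablePerturbation m V β) (hw : Continuous w)
    (hwK : ∀ x, ‖w x‖ ≤ K * weight β x) : Continuous (volterra m V w) :=
  continuous_iff_continuousAt.2 fun x => (h.hasDerivAt_volterra hw hwK x).continuousAt

theorem continuous_weight (h : IsIntegrablePerturbation m V β) : Continuous (weight β) :=
  MNLS.continuous_weight h.continuous_bound h.integrableOn_bound

theorem continuous_weight_smul (h : IsIntegrablePerturbation m V β) (v : ℝ →ᵇ (ι → ℂ)) :
    Continuous fun x => weight β x • v x :=
  h.continuous_weight.smul v.continuous

end IsIntegrablePerturbation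

theorem norm_weight_smul_le (v : ℝ →ᵇ (ι → ℂ)) (x : ℝ) :
    ‖weight β x • v x‖ ≤ ‖v‖ * weight β x := by
  rw [norm_smul, Real.norm_of_nonneg (weight_pos x).le, mul_comm]
  exact mul_le_mul_of_nonneg_right (v.norm_coe_le_norm x) (weight_pos x).le

theorem norm_inv_weight_smul (v : ι → ℂ) (x : ℝ) :
    ‖(weight β x)⁻¹ • v‖ = (weight β x)⁻¹ * ‖v‖ := by
  rw [norm_smul, norm_inv, Real.norm_of_nonneg (weight_pos x).le]

namespace IsIntegrablePerturbation

theorem norm_inv_weight_smul_volterra_le (h : IsIntegrablePerturbation m V β)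
    (v : ℝ →ᵇ (ι → ℂ)) (x : ℝ) :
    ‖(weight β x)⁻¹ • volterra m V (fun y => weight β y • v y) x‖ ≤ 1 / 2 * ‖v‖ := by
  rw [norm_inv_weight_smul, inv_mul_le_iff₀ (weight_pos x)]
  refine (h.norm_volterra_le (norm_nonneg v) (norm_weight_smul_le v) x).trans ?_
  linarith [norm_nonneg v]

/-- The Volterra operator conjugated by the weight, on bounded continuous functions. -/
noncomputable def weightedVolterra (h : IsIntegrablePerturbation m V β) :
    (ℝ →ᵇ (ι → ℂ)) →L[ℂ] (ℝ →ᵇ (ι → ℂ)) :=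
  LinearMap.mkContinuous
    { toFun v := BoundedContinuousFunction.ofNormedAddCommGroup
        (fun x => (weight β x)⁻¹ • volterra m V (fun y => weight β y • v y) x)
        ((h.continuous_weight.inv₀ fun x => (weight_pos x).ne').smul
          (h.continuous_volterra (h.continuous_weight_smul v) (norm_weight_smul_le v)))
        (1 / 2 * ‖v‖) (h.norm_inv_weight_smul_volterra_le v)
      map_add' v v' := by
        ext1 x
        simp only [BoundedContinuousFunction.coe_ofNormedAddCommGroup,
          BoundedContinuousFunction.coe_add, Pi.add_apply, smul_add]
        rw [h.volterra_add (h.continuous_weight_smul v) (h.continuous_weight_smul v')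
          (norm_weight_smul_le v) (norm_weight_smul_le v'), smul_add]
      map_smul' c v := by
        ext1 x
        simp only [BoundedContinuousFunction.coe_ofNormedAddCommGroup,
          BoundedContinuousFunction.coe_smul, RingHom.id_apply, smul_comm _ c,
          volterra_const_smul] }
    (1 / 2) fun v => BoundedContinuousFunction.norm_ofNormedAddCommGroup_le _ (by positivity)
      (h.norm_inv_weight_smul_volterra_le v)

theorem exists_eq_sub_volterra (h : IsIntegrablePerturbation m V β) (e : ι → ℂ) :
    ∃ (w : ℝ → ι → ℂ) (K : ℝ), 0 ≤ K ∧ Continuous w ∧ (∀ x, ‖w x‖ ≤ K * weight β x) ∧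
      ∀ x, w x = e - volterra m V w x := by
  let e' : ℝ →ᵇ (ι → ℂ) := BoundedContinuousFunction.ofNormedAddCommGroup
    (fun x => (weight β x)⁻¹ • e)
    ((h.continuous_weight.inv₀ fun x => (weight_pos x).ne').smul continuous_const) ‖e‖ fun x => by
      rw [norm_inv_weight_smul]
      exact mul_le_of_le_one_left (norm_nonneg _)
        (inv_le_one_of_one_le₀ (one_le_weight h.bound_nonneg x))
  have hnorm : ‖-h.weightedVolterra‖ < 1 := by
    refine (norm_neg h.weightedVolterra).trans_lt ?_
    exact (LinearMap.mkContinuous_norm_le _ (by positivity) _).trans_lt (by norm_num)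
  obtain ⟨v, hv⟩ : ∃ v, v + h.weightedVolterra v = e' := by
    obtain ⟨R, hR⟩ := (isUnit_one_sub_of_norm_lt_one (R := _ →L[ℂ] _)
      (x := -h.weightedVolterra) hnorm).exists_right_inv
    exact ⟨R e', (sub_neg_eq_add _ _).symm.trans (DFunLike.congr_fun hR e')⟩
  refine ⟨fun x => weight β x • v x, ‖v‖, norm_nonneg v, h.continuous_weight_smul v,
    norm_weight_smul_le v, fun x => ?_⟩
  have hx : v x + (weight β x)⁻¹ • volterra m V (fun y => weight β y • v y) x
      = (weight β x)⁻¹ • e := DFunLike.congr_fun hv x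
  beta_reduce
  rw [eq_sub_of_add_eq hx, ← smul_sub, smul_inv_smul₀ (weight_pos x).ne']

theorem tendsto_volterra_zero (h : IsIntegrablePerturbation m V β) (hK : 0 ≤ K)
    (hwK : ∀ x, ‖w x‖ ≤ K * weight β x) : Tendsto (volterra m V w) atTop (𝓝 0) := by
  refine squeeze_zero_norm (h.norm_volterra_le hK hwK) ?_
  simpa using ((tendsto_weight.sub_const 1).div_const 2).const_mul K

variable [DecidableEq ι]

theorem exists_solution_tendsto (h : IsIntegrablePerturbation m V β) (he : m * e = 0) :
    ∃ w : ℝ → ι → ℂ, (∀ x, HasDerivAt w ((diagonal m + V x) *ᵥ w x) x) ∧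
      Tendsto w atTop (𝓝 e) := by
  obtain ⟨w, K, hK, hwc, hwK, hfix⟩ := h.exists_eq_sub_volterra e
  have hw : w = fun x => e - volterra m V w x := funext hfix
  refine ⟨w, fun x => ?_, ?_⟩
  · have hderiv := (h.hasDerivAt_volterra hwc hwK x).const_sub e
    rw [← hw] at hderiv
    refine hderiv.congr_deriv ?_
    have hm : diagonal m *ᵥ w x = m * w x := funext fun i => mulVec_diagonal _ _ _
    rw [add_mulVec, hm, hfix x, mul_sub, he, ← hfix x]
    ring
  · rw [hw]
    simpa using (h.tendsto_volterra_zero hK hwK).const_sub e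

theorem norm_sub_le_mul_integral (h : IsIntegrablePerturbation m V β)
    (hw : ∀ x, HasDerivAt w ((diagonal m + V x) *ᵥ w x) x) (hlim : Tendsto w atTop (𝓝 e))
    (he : m * e = 0) {y S : ℝ} (hS : ∀ s, y ≤ s → ‖w s‖ ≤ S) :
    ‖w y - e‖ ≤ S * ∫ s in Set.Ioi y, β s := by
  have hS0 : 0 ≤ S := (norm_nonneg _).trans (hS y le_rfl)
  refine (pi_norm_le_iff_of_nonneg
    (mul_nonneg hS0 (integral_nonneg h.bound_nonneg))).2 fun i => ?_
  have hei : m i * e i = 0 := congr_fun he i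
  have hderiv (x : ℝ) : HasDerivAt (fun s : ℝ => exp (m i * (y - s)) * (w s i - e i))
      (exp (m i * (y - x)) * (V x *ᵥ w x) i) x := by
    have hexp : HasDerivAt (fun s : ℝ => m i * ((y : ℂ) - s)) (m i * -1) x :=
      ((hasDerivAt_id x).ofReal_comp.const_sub (y : ℂ)).const_mul _
    refine (hexp.cexp.mul ((hasDerivAt_pi.1 (hw x) i).sub_const (e i))).congr_deriv ?_
    rw [add_mulVec, Pi.add_apply, mulVec_diagonal]
    linear_combination exp (m i * (y - x)) * hei
  have hzero : Tendsto (fun s : ℝ => exp (m i * (y - s)) * (w s i - e i)) atTop (𝓝 0) := by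
    refine squeeze_zero_norm' (a := fun s => ‖w s i - e i‖) ?_
      (by simpa using ((tendsto_pi_nhds.1 hlim i).sub_const (e i)).norm)
    filter_upwards [eventually_ge_atTop y] with s hs
    rw [norm_mul]
    exact mul_le_of_le_one_left (norm_nonneg _) (norm_exp_mul_sub_le_one (h.re_nonneg i) hs)
  have hbound := norm_sub_le_integral_Ioi ((h.integrableOn_bound y).const_mul S) hderiv hzero
    fun s hs => (h.norm_kernel_le hs.le i (w s)).trans <| by
      rw [mul_comm]
      exact mul_le_mul_of_nonneg_right (hS s hs.le) (h.bound_nonneg s)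
  simpa only [integral_const_mul, sub_self, mul_zero, exp_zero, one_mul, sub_zero, Pi.sub_apply]
    using hbound

theorem norm_sub_le (h : IsIntegrablePerturbation m V β)
    (hw : ∀ x, HasDerivAt w ((diagonal m + V x) *ᵥ w x) x) (hlim : Tendsto w atTop (𝓝 e))
    (he : m * e = 0) {x : ℝ} (hsmall : ∫ s in Set.Ioi x, β s ≤ 1 / 2) :
    ‖w x - e‖ ≤ 2 * ‖e‖ * ∫ s in Set.Ioi x, β s := by
  have hwc : Continuous w := continuous_iff_continuousAt.2 fun s => (hw s).continuousAt
  set S := sSup ((fun y => ‖w y‖) '' Set.Ici x)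
  have hS (y : ℝ) (hy : x ≤ y) : ‖w y‖ ≤ S :=
    le_csSup (bddAbove_norm_image_Ici hwc hlim x) ⟨y, hy, rfl⟩
  have hS0 : 0 ≤ S := (norm_nonneg _).trans (hS x le_rfl)
  have habsorb : S ≤ ‖e‖ + S * (1 / 2) := by
    refine csSup_le (Set.nonempty_Ici.image _) (Set.forall_mem_image.2 fun y hy => ?_)
    have htail : ∫ s in Set.Ioi y, β s ≤ ∫ s in Set.Ioi x, β s :=
      setIntegral_mono_set (h.integrableOn_bound x) (Eventually.of_forall h.bound_nonneg)
        (Set.Ioi_subset_Ioi hy).eventuallyLE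
    calc ‖w y‖ ≤ ‖e‖ + ‖w y - e‖ := norm_le_insert' _ _
      _ ≤ ‖e‖ + S * (1 / 2) := add_le_add_right
          ((h.norm_sub_le_mul_integral hw hlim he fun s hs => hS s (hy.trans hs)).trans
            (mul_le_mul_of_nonneg_left (htail.trans hsmall) hS0)) _
  exact (h.norm_sub_le_mul_integral hw hlim he hS).trans
    (mul_le_mul_of_nonneg_right (by linarith) (integral_nonneg h.bound_nonneg))

end IsIntegrablePerturbation

end Perturbation


/-! ### Gauge transformations -/

section Gauge

variable {ι : Type*} [Fintype ι] {G H : ℝ → Matrix ι ι ℂ} {G' A M : Matrix ι ι ℂ} {x : ℝ}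

theorem hasDerivAt_mulVec {w : ℝ → ι → ℂ} {w' : ι → ℂ} (hG : HasDerivAt G G' x)
    (hw : HasDerivAt w w' x) : HasDerivAt (fun x => G x *ᵥ w x) (G' *ᵥ w x + G x *ᵥ w') x := by
  refine hasDerivAt_pi.2 fun i => ?_
  simp only [Pi.add_apply, mulVec, dotProduct, ← Finset.sum_add_distrib]
  exact HasDerivAt.fun_sum fun j _ =>
    (hasDerivAt_pi.1 (hasDerivAt_pi.1 hG i) j).mul (hasDerivAt_pi.1 hw j)

variable [DecidableEq ι]

open scoped Matrix.Norms.Operator in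
theorem hasDerivAt_right_inverse (hG : HasDerivAt G G' x) (hGH : ∀ y, G y * H y = 1) :
    HasDerivAt H (-(H x * G' * H x)) x := by
  let unit (y : ℝ) : (Matrix ι ι ℂ)ˣ := ⟨G y, H y, hGH y, mul_eq_one_comm.1 (hGH y)⟩
  have hinv : Ring.inverse ∘ G = H := funext fun y => Ring.inverse_unit (unit y)
  simpa [unit, hinv] using! (hasFDerivAt_ringInverse (𝕜 := ℝ) (unit x)).comp_hasDerivAt x hG

theorem hasDerivAt_gauge_iff {φ : ℝ → ι → ℂ} (hG : HasDerivAt G G' x) (hGH : ∀ y, G y * H y = 1)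
    (hM : G' + G x * A = M * G x) :
    HasDerivAt φ (A *ᵥ φ x) x ↔ HasDerivAt (fun y => G y *ᵥ φ y) (M *ᵥ (G x *ᵥ φ x)) x := by
  have hHG : ∀ y, H y * G y = 1 := fun y => mul_eq_one_comm.1 (hGH y)
  refine ⟨fun hφ => (hasDerivAt_mulVec hG hφ).congr_deriv ?_, fun hw => ?_⟩
  · rw [mulVec_mulVec, mulVec_mulVec, ← hM, add_mulVec]
  · have hφ : φ = fun y => H y *ᵥ (G y *ᵥ φ y) :=
      funext fun y => by rw [mulVec_mulVec, hHG, one_mulVec]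
    have hA : -(H x * G') + H x * (M * G x) = A := by
      rw [← hM, Matrix.mul_add, ← Matrix.mul_assoc _ _ A, hHG, Matrix.one_mul,
        neg_add_cancel_left]
    rw [hφ]
    refine (hasDerivAt_mulVec (hasDerivAt_right_inverse hG hGH) hw).congr_deriv ?_
    simp only [mulVec_mulVec, ← add_mulVec, Matrix.neg_mul, Matrix.mul_assoc, hHG,
      Matrix.mul_one, hA]

end Gauge

/-! ### The spectral functions -/

section Spectral

variable {α u₀ : ℝ} {z : ℂ}

theorem mul_specK_add_specLam (hα : α ≠ 0) : (α : ℂ) * specK α u₀ z + specLam u₀ z = z := by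
  have : (α : ℂ) ≠ 0 := ofReal_ne_zero.2 hα
  unfold specK specLam
  rcases eq_or_ne z 0 with rfl | hz
  · simp
  field_simp
  ring

theorem specLam_sub_mul_specK (hα : α ≠ 0) :
    specLam u₀ z - (α : ℂ) * specK α u₀ z = (u₀ : ℂ) ^ 2 / z := by
  have : (α : ℂ) ≠ 0 := ofReal_ne_zero.2 hα
  unfold specK specLam
  field_simp
  ring

theorem gam_eq (hz : z ≠ 0) : gam u₀ z = 2 * specLam u₀ z / z := by
  unfold gam specLam
  field_simp

theorem specK_div_self (hz : z ≠ 0) : specK α u₀ z / z = (2 - gam u₀ z) / (2 * α) := by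
  unfold specK gam
  field_simp
  ring

theorem gam_ne_zero (hz : z ≠ 0) (hlam : specLam u₀ z ≠ 0) : gam u₀ z ≠ 0 := by
  rw [gam_eq hz]
  exact div_ne_zero (mul_ne_zero two_ne_zero hlam) hz

theorem specLam_ne_zero (hz : z ≠ 0) (hpos : z ≠ I * u₀) (hneg : z ≠ -(I * u₀)) :
    specLam u₀ z ≠ 0 := by
  have hfactor : specLam u₀ z = (z - I * u₀) * (z - -(I * u₀)) / (2 * z) := by
    unfold specLam
    field_simp
    linear_combination (u₀ : ℂ) ^ 2 * I_sq
  rw [hfactor]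
  exact div_ne_zero (mul_ne_zero (sub_ne_zero.2 hpos) (sub_ne_zero.2 hneg))
    (mul_ne_zero two_ne_zero hz)

theorem eventually_cofinite_specLam_ne_zero (u₀ : ℝ) :
    ∀ᶠ z in cofinite, z ≠ 0 ∧ specLam u₀ z ≠ 0 := by
  filter_upwards [eventually_cofinite_ne 0, eventually_cofinite_ne (I * u₀ : ℂ),
    eventually_cofinite_ne (-(I * u₀) : ℂ)] with z hz hpos hneg
  exact ⟨hz, specLam_ne_zero hz hpos hneg⟩

theorem isBigO_gam_sub_one (u₀ : ℝ) :
    (fun z => gam u₀ z - 1) =O[Bornology.cobounded ℂ] fun z => z⁻¹ ^ 2 := by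
  have hgam : (fun z => gam u₀ z - 1) = fun z => (u₀ : ℂ) ^ 2 * z⁻¹ ^ 2 := by
    funext z
    rw [gam, add_sub_cancel_left, inv_pow, div_eq_mul_inv]
  rw [hgam]
  exact Asymptotics.isBigO_const_mul_self _ _ _

theorem tendsto_gam (u₀ : ℝ) : Tendsto (gam u₀) (Bornology.cobounded ℂ) (𝓝 1) := by
  have hpow : Tendsto (fun z : ℂ => z⁻¹ ^ 2) (Bornology.cobounded ℂ) (𝓝 0) := by
    simpa using (tendsto_inv₀_cobounded (α := ℂ)).pow 2
  simpa using ((isBigO_gam_sub_one u₀).trans_tendsto hpow).add_const 1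

theorem specK_mul_specLam :
    specK α u₀ z * specLam u₀ z = (z ^ 2 - (u₀ : ℂ) ^ 4 / z ^ 2) / (4 * α : ℝ) := by
  rcases eq_or_ne z 0 with rfl | hz
  · simp [specK]
  unfold specK specLam
  push_cast
  field_simp
  ring

theorem im_specK_mul_specLam (hz : z ≠ 0) :
    (specK α u₀ z * specLam u₀ z).im
      = z.re * z.im * (2 * (1 + u₀ ^ 4 / normSq z ^ 2) / (4 * α)) := by
  have hpow : (u₀ : ℂ) ^ 4 / z ^ 2
      = ((u₀ ^ 4 / normSq z ^ 2 : ℝ) : ℂ) * (starRingEnd ℂ z) ^ 2 := by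
    have hconj : starRingEnd ℂ z ≠ 0 := by simpa using hz
    push_cast
    rw [← mul_conj z]
    field_simp
  rw [specK_mul_specLam, hpow, div_ofReal_im, sub_im, im_ofReal_mul]
  simp only [pow_two, mul_im, conj_re, conj_im]
  ring

theorem hasDerivAt_exp_phase (t x : ℝ) (c : ℂ) :
    HasDerivAt (fun x : ℝ => exp (c * phase α u₀ x t z))
      (-(c * (specK α u₀ z * specLam u₀ z)) * exp (c * phase α u₀ x t z)) x := by
  have hphase : HasDerivAt (fun x : ℝ => c * phase α u₀ x t z)
      (c * -(specK α u₀ z * specLam u₀ z * 1)) x := by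
    unfold phase
    exact (((hasDerivAt_id x).ofReal_comp.add_const _).const_mul _).neg.const_mul c
  refine hphase.cexp.congr_deriv ?_
  ring

end Spectral


/-! ### Profiles -/

/-- `w` is a `C¹` profile on the line which approaches boundary values of modulus `u₀`, `um` at `-∞`
and `up` at `+∞`, integrably fast and with integrable derivative. -/
structure IsProfile (u₀ : ℝ) (um up : ℂ) (w : ℝ → ℂ) : Prop where
  pos : 0 < u₀
  norm_left : ‖um‖ = u₀
  norm_right : ‖up‖ = u₀
  contDiff : ContDiff ℝ 1 w
  tendsto_left : Tendsto w atBot (𝓝 um)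
  tendsto_right : Tendsto w atTop (𝓝 up)
  integrableOn_left : IntegrableOn (fun x => w x - um) (Set.Iic 0)
  integrableOn_right : IntegrableOn (fun x => w x - up) (Set.Ici 0)
  integrable_deriv : Integrable (deriv w)

namespace IsProfile

variable {α u₀ : ℝ} {um up : ℂ} {w : ℝ → ℂ}

theorem hasDerivAt (h : IsProfile u₀ um up w) (x : ℝ) : HasDerivAt w (deriv w x) x :=
  (h.contDiff.differentiable one_ne_zero x).hasDerivAt

theorem continuous_deriv (h : IsProfile u₀ um up w) : Continuous (deriv w) :=
  h.contDiff.continuous_deriv le_rfl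

theorem reflect (h : IsProfile u₀ um up w) :
    IsProfile u₀ (-starRingEnd ℂ up) (-starRingEnd ℂ um) fun x => -starRingEnd ℂ (w (-x)) where
  pos := h.pos
  norm_left := by rw [norm_neg, RCLike.norm_conj, h.norm_right]
  norm_right := by rw [norm_neg, RCLike.norm_conj, h.norm_left]
  contDiff := (conjCLE.contDiff.comp (h.contDiff.comp contDiff_neg)).neg
  tendsto_left :=
    ((continuous_conj.tendsto _).comp (h.tendsto_right.comp tendsto_neg_atBot_atTop)).neg
  tendsto_right :=
    ((continuous_conj.tendsto _).comp (h.tendsto_left.comp tendsto_neg_atTop_atBot)).neg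
  integrableOn_left := by
    have hneg : IntegrableOn (fun x => w (-x) - up) (Set.Iic 0) := by
      simpa using h.integrableOn_right.comp_neg
    refine (conjCLE.toContinuousLinearMap.integrable_comp hneg).neg.congr
      (Eventually.of_forall fun x => ?_)
    simp only [Pi.neg_apply, ContinuousLinearEquiv.coe_coe, conjCLE_apply, map_sub]
    ring
  integrableOn_right := by
    have hneg : IntegrableOn (fun x => w (-x) - um) (Set.Ici 0) := by
      simpa using h.integrableOn_left.comp_neg
    refine (conjCLE.toContinuousLinearMap.integrable_comp hneg).neg.congr
      (Eventually.of_forall fun x => ?_)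
    simp only [Pi.neg_apply, ContinuousLinearEquiv.coe_coe, conjCLE_apply, map_sub]
    ring
  integrable_deriv := by
    refine (conjCLE.toContinuousLinearMap.integrable_comp h.integrable_deriv.comp_neg).congr
      (Eventually.of_forall fun x => ?_)
    have hderiv := (((h.hasDerivAt (-x)).scomp x (hasDerivAt_neg x)).star).neg
    refine Eq.trans ?_ hderiv.deriv.symm
    simp [← starRingEnd_apply]

theorem exists_bound (h : IsProfile u₀ um up w) : ∃ K, ∀ x, ‖w x‖ ≤ K := by
  obtain ⟨K, hK⟩ := bddAbove_norm_image_Ici h.contDiff.continuous h.tendsto_right 0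
  obtain ⟨L, hL⟩ := bddAbove_norm_image_Ici (h.contDiff.continuous.comp continuous_neg)
    (h.tendsto_left.comp tendsto_neg_atTop_atBot) 0
  refine ⟨max K L, fun x => ?_⟩
  rcases le_total 0 x with hx | hx
  · exact (hK ⟨x, hx, rfl⟩).trans (le_max_left _ _)
  · exact (hL ⟨-x, neg_nonneg.2 hx, by simp⟩).trans (le_max_right _ _)

theorem continuous_sq_sub_norm_sq (h : IsProfile u₀ um up w) :
    Continuous fun y => u₀ ^ 2 - ‖w y‖ ^ 2 := by
  have := h.contDiff.continuous
  fun_prop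

theorem integrable_sq_sub_norm_sq (h : IsProfile u₀ um up w) :
    Integrable fun y => u₀ ^ 2 - ‖w y‖ ^ 2 := by
  obtain ⟨K, hK⟩ := h.exists_bound
  have hu₀ := h.pos.le
  have half_line : ∀ (v : ℂ) (s : Set ℝ), ‖v‖ = u₀ → IntegrableOn (fun x => w x - v) s →
      IntegrableOn (fun y => u₀ ^ 2 - ‖w y‖ ^ 2) s := fun v s hv hs => by
    refine Integrable.mono' (hs.norm.const_mul (u₀ + K))
      h.continuous_sq_sub_norm_sq.aestronglyMeasurable (Eventually.of_forall fun x => ?_)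
    have hsub : |u₀ - ‖w x‖| ≤ ‖w x - v‖ := by
      rw [← hv, norm_sub_rev]
      exact abs_norm_sub_norm_le v (w x)
    calc ‖u₀ ^ 2 - ‖w x‖ ^ 2‖ = (u₀ + ‖w x‖) * |u₀ - ‖w x‖| := by
          rw [sq_sub_sq, norm_mul, Real.norm_eq_abs, Real.norm_eq_abs,
            abs_of_nonneg (by positivity : 0 ≤ u₀ + ‖w x‖)]
      _ ≤ (u₀ + K) * ‖w x - v‖ := by
          gcongr
          · linarith [(norm_nonneg _).trans (hK x)]
          · exact hK x
  have hunion := (half_line um _ h.norm_left h.integrableOn_left).union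
    (half_line up _ h.norm_right h.integrableOn_right)
  rwa [Set.Iic_union_Ici, integrableOn_univ] at hunion

end IsProfile

/-- The tail `(1 / 2α) ∫ₓ^∞ (u₀² - |w|²) dy` of the integral `ν₀`. -/
noncomputable def tailPhase (α u₀ : ℝ) (w : ℝ → ℂ) (x : ℝ) : ℝ :=
  1 / (2 * α) * ∫ y in Set.Ioi x, (u₀ ^ 2 - ‖w y‖ ^ 2)

namespace IsProfile

variable {α u₀ : ℝ} {um up : ℂ} {w : ℝ → ℂ}

theorem hasDerivAt_tailPhase (h : IsProfile u₀ um up w) (x : ℝ) :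
    HasDerivAt (tailPhase α u₀ w) (-(1 / (2 * α) * (u₀ ^ 2 - ‖w x‖ ^ 2))) x :=
  ((hasDerivAt_integral_Ioi h.continuous_sq_sub_norm_sq
    (fun _ => h.integrable_sq_sub_norm_sq.integrableOn) x).const_mul _).congr_deriv (mul_neg _ _)

theorem continuous_tailPhase (h : IsProfile u₀ um up w) : Continuous (tailPhase α u₀ w) :=
  continuous_iff_continuousAt.2 fun x => (h.hasDerivAt_tailPhase x).continuousAt

theorem tailPhase_add_tailPhase_reflect {u : ℝ → ℝ → ℂ} {t : ℝ}
    (h : IsProfile u₀ um up fun x => u x t) (x : ℝ) :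
    tailPhase α u₀ (fun x => u x t) x
      + tailPhase α u₀ (fun x => -starRingEnd ℂ (u (-x) t)) (-x) = nu0 α u₀ u t := by
  have hint := h.integrable_sq_sub_norm_sq
  have hreflect : ∫ y in Set.Ioi (-x), (u₀ ^ 2 - ‖-starRingEnd ℂ (u (-y) t)‖ ^ 2)
      = ∫ y in Set.Iic x, (u₀ ^ 2 - ‖u y t‖ ^ 2) := by
    simpa using integral_comp_neg_Ioi (-x) fun y => u₀ ^ 2 - ‖u y t‖ ^ 2
  rw [tailPhase, tailPhase, nu0, hreflect, ← mul_add, add_comm,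
    intervalIntegral.integral_Iic_add_Ioi hint.integrableOn hint.integrableOn]

end IsProfile

theorem tendsto_tailPhase (α u₀ : ℝ) (w : ℝ → ℂ) : Tendsto (tailPhase α u₀ w) atTop (𝓝 0) := by
  have htail : Tendsto (fun x => ∫ y in Set.Ioi x, (u₀ ^ 2 - ‖w y‖ ^ 2)) atTop (𝓝 0) :=
    tendsto_integral_Ioi_zero tendsto_id
  simpa only [mul_zero] using! htail.const_mul (1 / (2 * α))


/-! ### The gauge -/

/-- A matrix with inverse `diagonalizerInv u₀ z w` that diagonalizes `laxX α u₀ z w` when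
`‖w‖ = u₀`, and up to terms with the factor `u₀² - ‖w‖²` otherwise. -/
noncomputable def diagonalizer (u₀ : ℝ) (z w : ℂ) : Matrix (Fin 2) (Fin 2) ℂ :=
  !![1 - starRingEnd ℂ w / z * (w / (2 * specLam u₀ z)), -(w / (2 * specLam u₀ z));
    starRingEnd ℂ w / z, 1]

/-- The inverse of `diagonalizer u₀ z w`. Its first column is that of `eigY z w`. -/
noncomputable def diagonalizerInv (u₀ : ℝ) (z w : ℂ) : Matrix (Fin 2) (Fin 2) ℂ :=
  !![1, w / (2 * specLam u₀ z);
    -(starRingEnd ℂ w / z), 1 - starRingEnd ℂ w / z * (w / (2 * specLam u₀ z))]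

/-- The off-diagonal entry of `residual α u₀ z w w'` below the diagonal. -/
noncomputable def residualLower (α u₀ : ℝ) (z w w' : ℂ) : ℂ :=
  I * (specK α u₀ z / z) * ((u₀ ^ 2 - ‖w‖ ^ 2 : ℝ) : ℂ) * (starRingEnd ℂ w / z)
    + starRingEnd ℂ w' / z

/-- What the gauge transformation by `diagonalizer u₀ z (w x)` leaves of the spatial part of the Lax
pair besides its eigenvalues and the integrand of `tailPhase`, at a point where the potential has
the value `w` and the derivative `w'`. -/
noncomputable def residual (α u₀ : ℝ) (z w w' : ℂ) : Matrix (Fin 2) (Fin 2) ℂ :=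
  let q : ℂ := (u₀ ^ 2 - ‖w‖ ^ 2 : ℝ)
  let B := w / (2 * specLam u₀ z)
  let r := residualLower α u₀ z w w'
  let p := I * (specK α u₀ z / z - 1 / (2 * α)) * q - B * r
  !![p, 2 * I * (specK α u₀ z / z) * q * B - w' / (2 * specLam u₀ z) - B ^ 2 * r; r, -p]

section Diagonalizer

variable {α u₀ : ℝ} {z w w' : ℂ}

theorem diagonalizer_mul_diagonalizerInv : diagonalizer u₀ z w * diagonalizerInv u₀ z w = 1 := by
  ext i j
  fin_cases i <;> fin_cases j <;>
    simp [diagonalizer, diagonalizerInv, Matrix.mul_apply, Fin.sum_univ_two] <;> ring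

theorem hasDerivAt_diagonalizer {f : ℝ → ℂ} {x : ℝ} (hf : HasDerivAt f w' x) :
    HasDerivAt (fun x => diagonalizer u₀ z (f x))
      !![-(starRingEnd ℂ w' / z * (f x / (2 * specLam u₀ z))
          + starRingEnd ℂ (f x) / z * (w' / (2 * specLam u₀ z))), -(w' / (2 * specLam u₀ z));
        starRingEnd ℂ w' / z, 0] x := by
  have hconj : HasDerivAt (fun x => starRingEnd ℂ (f x) / z) (starRingEnd ℂ w' / z) x :=
    hf.star.div_const z
  have hdiv := hf.div_const (2 * specLam u₀ z)
  refine hasDerivAt_pi.2 fun i => hasDerivAt_pi.2 fun j => ?_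
  fin_cases i <;> fin_cases j
  · exact (hconj.mul hdiv).const_sub 1
  · exact hdiv.neg
  · exact hconj
  · exact hasDerivAt_const x 1

theorem laxX_eq : laxX α u₀ z w = !![-(I * α * specK α u₀ z ^ 2), I * specK α u₀ z * w;
    I * specK α u₀ z * starRingEnd ℂ w, I * α * specK α u₀ z ^ 2] := by
  ext i j
  fin_cases i <;> fin_cases j <;> simp [laxX, potQ, sigma3]

theorem diagonalizer_mul_laxX (hα : α ≠ 0) (hz : z ≠ 0) (hlam : specLam u₀ z ≠ 0) :
    !![-(starRingEnd ℂ w' / z * (w / (2 * specLam u₀ z))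
        + starRingEnd ℂ w / z * (w' / (2 * specLam u₀ z))), -(w' / (2 * specLam u₀ z));
        starRingEnd ℂ w' / z, 0] + diagonalizer u₀ z w * laxX α u₀ z w
      = ((I * (((u₀ ^ 2 - ‖w‖ ^ 2 : ℝ) : ℂ) / (2 * α) - specK α u₀ z * specLam u₀ z)) • sigma3
        + residual α u₀ z w w') * diagonalizer u₀ z w := by
  have hsum := mul_specK_add_specLam (u₀ := u₀) (z := z) hα
  have hdiff := specLam_sub_mul_specK (u₀ := u₀) (z := z) hα
  simp only [laxX_eq, residual, residualLower, diagonalizer]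
  have hws : w * (starRingEnd ℂ w / z)
      = specLam u₀ z - α * specK α u₀ z - ((u₀ ^ 2 - ‖w‖ ^ 2 : ℝ) : ℂ) / z := by
    rw [hdiff, mul_div_assoc', mul_conj']
    push_cast
    ring
  have hconj : starRingEnd ℂ w = starRingEnd ℂ w / z * (α * specK α u₀ z + specLam u₀ z) := by
    rw [hsum, div_mul_cancel₀ _ hz]
  have hw : w = 2 * (w / (2 * specLam u₀ z)) * specLam u₀ z := by field_simp
  generalize ((u₀ ^ 2 - ‖w‖ ^ 2 : ℝ) : ℂ) = q at *
  generalize starRingEnd ℂ w / z = s at *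
  generalize w / (2 * specLam u₀ z) = B at *
  generalize w' / (2 * specLam u₀ z) = B' at *
  generalize starRingEnd ℂ w' / z = s' at *
  generalize specK α u₀ z = k at *
  generalize specLam u₀ z = l at *
  ext i j
  fin_cases i <;> fin_cases j <;>
    simp only [Fin.zero_eta, Fin.mk_one, sigma3, Matrix.add_apply, Matrix.mul_apply,
      Matrix.smul_apply, Fin.sum_univ_two, of_apply, cons_val', cons_val_zero, cons_val_one,
      cons_val_fin_one, smul_eq_mul]
  · linear_combination -(I * k * B) * hconj - I * k * hws + I * k * s * hw
  · linear_combination I * k * hw - I * k * B * hws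
  · linear_combination I * k * hconj
  · linear_combination I * k * hws

end Diagonalizer

/-- The gauge transformation that turns the Lax system into `w' = (diag(0, 2ikλ) + V) w` with
`V = gaugedResidual α u₀ z w`. -/
noncomputable def gauge (α u₀ t : ℝ) (z : ℂ) (w : ℝ → ℂ) (x : ℝ) : Matrix (Fin 2) (Fin 2) ℂ :=
  exp (-(I * phase α u₀ x t z)) • (expSigma3 (I * tailPhase α u₀ w x) * diagonalizer u₀ z (w x))

/-- The inverse of `gauge`. -/
noncomputable def gaugeInv (α u₀ t : ℝ) (z : ℂ) (w : ℝ → ℂ) (x : ℝ) : Matrix (Fin 2) (Fin 2) ℂ :=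
  exp (I * phase α u₀ x t z) •
    (diagonalizerInv u₀ z (w x) * expSigma3 (-(I * tailPhase α u₀ w x)))

/-- The perturbation in the gauge-transformed Lax system. -/
noncomputable def gaugedResidual (α u₀ : ℝ) (z : ℂ) (w : ℝ → ℂ) (x : ℝ) :
    Matrix (Fin 2) (Fin 2) ℂ :=
  expSigma3 (I * tailPhase α u₀ w x) * residual α u₀ z (w x) (deriv w x)
    * expSigma3 (-(I * tailPhase α u₀ w x))

theorem expSigma3_mul_expSigma3_neg (a : ℂ) : expSigma3 a * expSigma3 (-a) = 1 := by
  ext i j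
  fin_cases i <;> fin_cases j <;> simp [expSigma3, Matrix.mul_apply, ← exp_add]

theorem expSigma3_neg_mul_expSigma3 (a : ℂ) : expSigma3 (-a) * expSigma3 a = 1 := by
  simpa using expSigma3_mul_expSigma3_neg (-a)

theorem expSigma3_eq_diagonal (a : ℂ) : expSigma3 a = diagonal ![exp a, exp (-a)] := by
  ext i j
  fin_cases i <;> fin_cases j <;> simp [expSigma3]

theorem hasDerivAt_expSigma3 {a : ℝ → ℂ} {a' : ℂ} {x : ℝ} (ha : HasDerivAt a a' x) :
    HasDerivAt (fun x => expSigma3 (a x)) (expSigma3 (a x) * a' • sigma3) x := by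
  have hentries : expSigma3 (a x) * a' • sigma3
      = !![exp (a x) * a', 0; 0, exp (-a x) * -a'] := by
    ext i j
    fin_cases i <;> fin_cases j <;> simp [expSigma3, sigma3, Matrix.mul_apply]
  rw [hentries]
  refine hasDerivAt_pi.2 fun i => hasDerivAt_pi.2 fun j => ?_
  fin_cases i <;> fin_cases j
  · exact ha.cexp
  · exact hasDerivAt_const x 0
  · exact hasDerivAt_const x 0
  · exact ha.neg.cexp

section Gauge

variable {α u₀ t : ℝ} {z um up : ℂ} {w : ℝ → ℂ}

theorem gauge_mul_gaugeInv (x : ℝ) : gauge α u₀ t z w x * gaugeInv α u₀ t z w x = 1 := by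
  rw [gauge, gaugeInv, smul_mul_smul_comm, ← exp_add, neg_add_cancel, exp_zero, one_smul,
    Matrix.mul_assoc, ← Matrix.mul_assoc (diagonalizer _ _ _), diagonalizer_mul_diagonalizerInv,
    Matrix.one_mul, expSigma3_mul_expSigma3_neg]

theorem diagonal_add_gaugedResidual_mul_gauge (c : ℂ) (x : ℝ) :
    (diagonal ![0, 2 * c] + gaugedResidual α u₀ z w x) * gauge α u₀ t z w x
      = exp (-(I * phase α u₀ x t z)) • (expSigma3 (I * tailPhase α u₀ w x)
        * (c • (1 - sigma3) + residual α u₀ z (w x) (deriv w x)) * diagonalizer u₀ z (w x)) := by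
  have hdiag (a : ℂ) : diagonal ![0, 2 * c] * expSigma3 a = expSigma3 a * (c • (1 - sigma3)) := by
    ext i j
    fin_cases i <;> fin_cases j <;>
      (simp [expSigma3, sigma3, Matrix.mul_apply]; try ring)
  have hresidual : gaugedResidual α u₀ z w x * expSigma3 (I * tailPhase α u₀ w x)
      = expSigma3 (I * tailPhase α u₀ w x) * residual α u₀ z (w x) (deriv w x) := by
    rw [gaugedResidual, Matrix.mul_assoc, expSigma3_neg_mul_expSigma3, Matrix.mul_one]
  rw [gauge, Matrix.mul_smul, ← Matrix.mul_assoc, Matrix.add_mul, hdiag, hresidual, Matrix.mul_add]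

open scoped Matrix.Norms.Operator in
theorem IsProfile.hasDerivAt_gauge (h : IsProfile u₀ um up w) (hα : α ≠ 0) (hz : z ≠ 0)
    (hlam : specLam u₀ z ≠ 0) (x : ℝ) :
    HasDerivAt (gauge α u₀ t z w)
      ((diagonal ![0, 2 * (I * (specK α u₀ z * specLam u₀ z))] + gaugedResidual α u₀ z w x)
          * gauge α u₀ t z w x - gauge α u₀ t z w x * laxX α u₀ z (w x)) x := by
  set κ := specK α u₀ z * specLam u₀ z with hκ
  set q : ℂ := ((u₀ ^ 2 - ‖w x‖ ^ 2 : ℝ) : ℂ) with hq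
  obtain ⟨R', hR', hdiag⟩ : ∃ R', HasDerivAt (fun x => diagonalizer u₀ z (w x)) R' x ∧
      R' + diagonalizer u₀ z (w x) * laxX α u₀ z (w x)
        = ((I * (q / (2 * α) - κ)) • sigma3 + residual α u₀ z (w x) (deriv w x))
          * diagonalizer u₀ z (w x) :=
    ⟨_, hasDerivAt_diagonalizer (h.hasDerivAt x), diagonalizer_mul_laxX hα hz hlam⟩
  have hphase : HasDerivAt (fun x => exp (-(I * phase α u₀ x t z)))
      (I * κ * exp (-(I * phase α u₀ x t z))) x := by
    simpa [hκ] using hasDerivAt_exp_phase t x (-I)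
  have htail : HasDerivAt (fun x => I * (tailPhase α u₀ w x : ℂ)) (-(I * (q / (2 * α)))) x := by
    refine ((h.hasDerivAt_tailPhase x).ofReal_comp.const_mul I).congr_deriv ?_
    rw [hq]
    push_cast
    ring
  refine (hphase.smul ((hasDerivAt_expSigma3 htail).mul hR')).congr_deriv ?_
  rw [diagonal_add_gaugedResidual_mul_gauge, gauge, eq_sub_of_add_eq hdiag]
  simp only [Matrix.mul_assoc, Matrix.mul_add, Matrix.add_mul, Matrix.mul_sub, Matrix.sub_mul,
    Matrix.mul_smul, Matrix.smul_mul, Matrix.one_mul]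
  module

theorem IsProfile.hasDerivAt_iff_gauge (h : IsProfile u₀ um up w) (hα : α ≠ 0) (hz : z ≠ 0)
    (hlam : specLam u₀ z ≠ 0) {φ : ℝ → Fin 2 → ℂ} {x : ℝ} :
    HasDerivAt φ (laxX α u₀ z (w x) *ᵥ φ x) x ↔
      HasDerivAt (fun y => gauge α u₀ t z w y *ᵥ φ y)
        ((diagonal ![0, 2 * (I * (specK α u₀ z * specLam u₀ z))] + gaugedResidual α u₀ z w x)
          *ᵥ (gauge α u₀ t z w x *ᵥ φ x)) x :=
  hasDerivAt_gauge_iff (h.hasDerivAt_gauge hα hz hlam x) gauge_mul_gaugeInv (sub_add_cancel _ _)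

end Gauge

/-! ### Size of the perturbation -/

/-- The bounds on the spectral parameter `z` that control `residual α u₀ z w w'` when `‖w‖ ≤ K`. The
parameter `ε`, of the order of `z⁻¹` for large `z`, is the factor by which the residual is small. -/
structure IsSpectralBound (α u₀ K ε : ℝ) (z : ℂ) : Prop where
  one_le : 1 ≤ K
  le : ε ≤ K
  norm_inv_le : ‖z⁻¹‖ ≤ ε
  norm_inv_specLam_le : ‖(2 * specLam u₀ z)⁻¹‖ ≤ ε
  norm_specK_div_le : ‖specK α u₀ z / z‖ ≤ K
  norm_specK_div_sub_le : ‖specK α u₀ z / z - 1 / (2 * α)‖ ≤ K * ε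

section Residual

variable {α u₀ K ε : ℝ} {z w w' : ℂ}

theorem eventually_isSpectralBound (α u₀ : ℝ) (z : ℂ) :
    ∀ᶠ K in atTop, IsSpectralBound α u₀ K K z := by
  filter_upwards [eventually_ge_atTop 1, eventually_ge_atTop ‖z⁻¹‖,
    eventually_ge_atTop ‖(2 * specLam u₀ z)⁻¹‖, eventually_ge_atTop ‖specK α u₀ z / z‖,
    eventually_ge_atTop ‖specK α u₀ z / z - 1 / (2 * α)‖] with K h₁ hinv hlam hk hsub
  exact ⟨h₁, le_rfl, hinv, hlam, hk, hsub.trans (le_mul_of_one_le_left (by linarith) h₁)⟩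

theorem eventually_isSpectralBound_cobounded (α u₀ : ℝ) :
    ∀ᶠ K in atTop, ∀ᶠ z in Bornology.cobounded ℂ, IsSpectralBound α u₀ K (2 * ‖z⁻¹‖) z := by
  filter_upwards [eventually_ge_atTop 2, eventually_ge_atTop (2 * ‖(2 * α : ℂ)⁻¹‖),
    eventually_ge_atTop (u₀ ^ 2 * ‖(2 * α : ℂ)⁻¹‖)] with K h₂ hα hu₀
  filter_upwards [(tendsto_gam u₀).eventually (Metric.closedBall_mem_nhds 1 one_half_pos),
    eventually_cobounded_le_norm (1 : ℝ)] with z hgam hz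
  rw [dist_eq_norm] at hgam
  have hz₀ : z ≠ 0 := norm_pos_iff.1 (by linarith)
  have hinv : ‖z⁻¹‖ ≤ 1 := by
    rw [norm_inv]
    exact inv_le_one_of_one_le₀ hz
  refine ⟨by linarith, by linarith, by linarith [norm_nonneg z⁻¹], ?_, ?_, ?_⟩
  · have hgam_ge : 1 / 2 ≤ ‖gam u₀ z‖ := by
      have := norm_sub_norm_le 1 (gam u₀ z)
      rw [norm_one, norm_sub_rev] at this
      linarith
    have hlam : (2 * specLam u₀ z)⁻¹ = (gam u₀ z)⁻¹ * z⁻¹ := by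
      rw [← mul_inv, gam_eq hz₀, div_mul_cancel₀ _ hz₀]
    rw [hlam, norm_mul, norm_inv (gam u₀ z)]
    gcongr
    exact inv_le_of_inv_le₀ two_pos (by linarith)
  · have htwo : ‖2 - gam u₀ z‖ ≤ 2 := by
      have := norm_sub_le (1 : ℂ) (gam u₀ z - 1)
      rw [norm_one, show 1 - (gam u₀ z - 1) = 2 - gam u₀ z by ring] at this
      linarith
    rw [specK_div_self hz₀, div_eq_mul_inv, norm_mul]
    exact (mul_le_mul_of_nonneg_right htwo (norm_nonneg _)).trans hα
  · have hsub : specK α u₀ z / z - 1 / (2 * α) = -((u₀ : ℂ) ^ 2 * (2 * α : ℂ)⁻¹ * (z⁻¹ * z⁻¹)) := by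
      rw [specK_div_self hz₀, gam]
      ring
    rw [hsub, norm_neg, norm_mul, norm_mul, norm_mul, norm_pow, norm_real, Real.norm_eq_abs, sq_abs]
    gcongr
    nlinarith [norm_nonneg z⁻¹]

theorem isBigO_inv_specLam (u₀ : ℝ) :
    (fun z => (2 * specLam u₀ z)⁻¹) =O[Bornology.cobounded ℂ] fun z => z⁻¹ := by
  obtain ⟨K, hK⟩ := (eventually_isSpectralBound_cobounded 1 u₀).exists
  refine .of_bound 2 ?_
  filter_upwards [hK] with z hz using hz.norm_inv_specLam_le

theorem IsSpectralBound.nonneg (h : IsSpectralBound α u₀ K ε z) : 0 ≤ ε :=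
  (norm_nonneg _).trans h.norm_inv_le

theorem IsSpectralBound.norm_conj_div_le (h : IsSpectralBound α u₀ K ε z) (v : ℂ) :
    ‖starRingEnd ℂ v / z‖ ≤ ‖v‖ * ε := by
  rw [div_eq_mul_inv, norm_mul, RCLike.norm_conj]
  gcongr
  exact h.norm_inv_le

theorem IsSpectralBound.norm_div_specLam_le (h : IsSpectralBound α u₀ K ε z) (v : ℂ) :
    ‖v / (2 * specLam u₀ z)‖ ≤ ‖v‖ * ε := by
  rw [div_eq_mul_inv, norm_mul]
  gcongr
  exact h.norm_inv_specLam_le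

theorem IsSpectralBound.norm_residualLower_le (h : IsSpectralBound α u₀ K ε z) (hw : ‖w‖ ≤ K) :
    ‖residualLower α u₀ z w w'‖ ≤ K ^ 2 * ε * (|u₀ ^ 2 - ‖w‖ ^ 2| + ‖w'‖) := by
  have hK := h.one_le
  have hε := h.nonneg
  calc ‖residualLower α u₀ z w w'‖
      ≤ 1 * K * |u₀ ^ 2 - ‖w‖ ^ 2| * (K * ε) + ‖w'‖ * ε := by
        refine norm_add_le_of_le ?_ (h.norm_conj_div_le w')
        simp only [norm_mul, norm_I, norm_real, Real.norm_eq_abs]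
        gcongr
        · exact h.norm_specK_div_le
        · exact (h.norm_conj_div_le w).trans (by gcongr)
    _ = K ^ 2 * ε * |u₀ ^ 2 - ‖w‖ ^ 2| + 1 * ε * ‖w'‖ := by ring
    _ ≤ K ^ 2 * ε * |u₀ ^ 2 - ‖w‖ ^ 2| + K ^ 2 * ε * ‖w'‖ := by
        gcongr
        exact one_le_pow₀ hK
    _ = _ := by ring

theorem IsSpectralBound.norm_residual_diag_le (h : IsSpectralBound α u₀ K ε z) (hw : ‖w‖ ≤ K) :
    ‖residual α u₀ z w w' 0 0‖ ≤ 4 * K ^ 6 * ε * (|u₀ ^ 2 - ‖w‖ ^ 2| + ‖w'‖) := by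
  set d := |u₀ ^ 2 - ‖w‖ ^ 2| + ‖w'‖
  have hK := h.one_le
  have hε := h.nonneg
  have hB : ‖w / (2 * specLam u₀ z)‖ ≤ K * K :=
    (h.norm_div_specLam_le w).trans (by gcongr; exact h.le)
  calc ‖residual α u₀ z w w' 0 0‖ ≤ 1 * (K * ε) * d + K * K * (K ^ 2 * ε * d) := by
        refine norm_sub_le_of_le ?_ ?_
        · simp only [norm_mul, norm_I, norm_real, Real.norm_eq_abs]
          gcongr
          · exact h.norm_specK_div_sub_le
          · exact le_add_of_nonneg_right (norm_nonneg _)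
        · rw [norm_mul]
          gcongr
          exact h.norm_residualLower_le hw
    _ = K ^ 1 * (ε * d) + K ^ 4 * (ε * d) := by ring
    _ ≤ K ^ 6 * (ε * d) + K ^ 6 * (ε * d) := by gcongr <;> norm_num
    _ ≤ 4 * K ^ 6 * ε * d := by
        have : 0 ≤ K ^ 6 * (ε * d) := by positivity
        linarith

theorem IsSpectralBound.norm_residual_upper_le (h : IsSpectralBound α u₀ K ε z) (hw : ‖w‖ ≤ K) :
    ‖residual α u₀ z w w' 0 1‖ ≤ 4 * K ^ 6 * ε * (|u₀ ^ 2 - ‖w‖ ^ 2| + ‖w'‖) := by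
  set d := |u₀ ^ 2 - ‖w‖ ^ 2| + ‖w'‖
  have hK := h.one_le
  have hε := h.nonneg
  have hB : ‖w / (2 * specLam u₀ z)‖ ≤ K * ε := (h.norm_div_specLam_le w).trans (by gcongr)
  have hB' : ‖w / (2 * specLam u₀ z)‖ ≤ K * K := hB.trans (by gcongr; exact h.le)
  calc ‖residual α u₀ z w w' 0 1‖
      ≤ 2 * 1 * K * d * (K * ε) + d * ε + (K * K) ^ 2 * (K ^ 2 * ε * d) := by
        refine norm_sub_le_of_le (norm_sub_le_of_le ?_ ((h.norm_div_specLam_le w').trans ?_)) ?_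
        · simp only [norm_mul, norm_I, norm_real, Real.norm_eq_abs, norm_ofNat]
          gcongr
          · exact h.norm_specK_div_le
          · exact le_add_of_nonneg_right (norm_nonneg _)
        · gcongr
          exact le_add_of_nonneg_left (abs_nonneg _)
        · rw [norm_mul, norm_pow]
          gcongr
          exact h.norm_residualLower_le hw
    _ = 2 * (K ^ 2 * (ε * d)) + K ^ 0 * (ε * d) + K ^ 6 * (ε * d) := by ring
    _ ≤ 2 * (K ^ 6 * (ε * d)) + K ^ 6 * (ε * d) + K ^ 6 * (ε * d) := by
        gcongr <;> norm_num
    _ = 4 * K ^ 6 * ε * d := by ring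

theorem IsSpectralBound.norm_residual_le (h : IsSpectralBound α u₀ K ε z) (hw : ‖w‖ ≤ K)
    (i j : Fin 2) : ‖residual α u₀ z w w' i j‖ ≤ 4 * K ^ 6 * ε * (|u₀ ^ 2 - ‖w‖ ^ 2| + ‖w'‖) := by
  fin_cases i <;> fin_cases j
  · exact h.norm_residual_diag_le hw
  · exact h.norm_residual_upper_le hw
  · refine (h.norm_residualLower_le hw).trans ?_
    have hε := h.nonneg
    have hK := h.one_le
    have hpow : K ^ 2 ≤ K ^ 6 := pow_le_pow_right₀ hK (by norm_num)
    gcongr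
    linarith [sq_nonneg K]
  · exact (norm_neg _).trans_le (h.norm_residual_diag_le hw)

theorem norm_mulVec_le_of_entries {ι : Type*} [Fintype ι] {A : Matrix ι ι ℂ} {c : ℝ}
    (hA : ∀ i j, ‖A i j‖ ≤ c) (hc : 0 ≤ c) (y : ι → ℂ) :
    ‖A *ᵥ y‖ ≤ Fintype.card ι * c * ‖y‖ := by
  refine (pi_norm_le_iff_of_nonneg (by positivity)).2 fun i => ?_
  calc ‖∑ j, A i j * y j‖ ≤ ∑ _j : ι, c * ‖y‖ :=
        norm_sum_le_of_le _ fun j _ => (norm_mul_le _ _).trans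
          (mul_le_mul (hA i j) (norm_le_pi_norm y j) (norm_nonneg _) hc)
    _ = Fintype.card ι * c * ‖y‖ := by
        rw [Finset.sum_const, Finset.card_univ, nsmul_eq_mul, mul_assoc]

theorem zero_cons_mul_cons_zero {a b : ℂ} : ![0, a] * ![b, 0] = 0 := by
  ext i
  fin_cases i <;> simp

theorem norm_gaugedResidual_apply {f : ℝ → ℂ} (x : ℝ) (i j : Fin 2) :
    ‖gaugedResidual α u₀ z f x i j‖ = ‖residual α u₀ z (f x) (deriv f x) i j‖ := by
  have hexp (b : ℝ) : ‖exp (I * b)‖ = 1 := norm_exp_I_mul_ofReal b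
  have hexp' (b : ℝ) : ‖exp (-(I * b))‖ = 1 := by simpa using hexp (-b)
  fin_cases i <;> fin_cases j <;>
    simp [gaugedResidual, expSigma3_eq_diagonal, hexp, hexp']

end Residual

/-! ### The Jost column `φ₊,₁` -/

/-- The density whose integrals over half-lines measure the size of `gaugedResidual`. -/
noncomputable def residualDensity (u₀ : ℝ) (w : ℝ → ℂ) (x : ℝ) : ℝ :=
  |u₀ ^ 2 - ‖w x‖ ^ 2| + ‖deriv w x‖

theorem continuous_expSigma3 : Continuous expSigma3 := by
  refine continuous_matrix fun i j => ?_
  fin_cases i <;> fin_cases j <;> simp only [expSigma3] <;> fun_prop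

theorem continuous_residual {α u₀ : ℝ} {z : ℂ} :
    Continuous fun p : ℂ × ℂ => residual α u₀ z p.1 p.2 := by
  refine continuous_matrix fun i j => ?_
  fin_cases i <;> fin_cases j <;> simp only [residual, residualLower] <;> fun_prop

theorem continuous_diagonalizer {u₀ : ℝ} {z : ℂ} : Continuous (diagonalizer u₀ z) := by
  refine continuous_matrix fun i j => ?_
  fin_cases i <;> fin_cases j <;> simp only [diagonalizer] <;> fun_prop

theorem continuous_diagonalizerInv {u₀ : ℝ} {z : ℂ} : Continuous (diagonalizerInv u₀ z) := by
  refine continuous_matrix fun i j => ?_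
  fin_cases i <;> fin_cases j <;> simp only [diagonalizerInv] <;> fun_prop

theorem diagonalizerInv_mulVec {u₀ : ℝ} {z v : ℂ} :
    diagonalizerInv u₀ z v *ᵥ ![1, 0] = fun i => eigY z v i 0 := by
  funext i
  fin_cases i <;> simp [diagonalizerInv, eigY, sigma3, potQ, Matrix.mulVec, dotProduct,
    div_eq_inv_mul]

theorem exp_phase_smul_eq {α u₀ t x : ℝ} {z : ℂ} {w : ℝ → ℂ} {φ : Fin 2 → ℂ} :
    exp (-(I * phase α u₀ x t z)) • φ
      = (diagonalizerInv u₀ z (w x) * expSigma3 (-(I * tailPhase α u₀ w x)))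
        *ᵥ (gauge α u₀ t z w x *ᵥ φ) := by
  have hinv : gaugeInv α u₀ t z w x * gauge α u₀ t z w x = 1 :=
    mul_eq_one_comm.1 (gauge_mul_gaugeInv x)
  have hsmul : diagonalizerInv u₀ z (w x) * expSigma3 (-(I * tailPhase α u₀ w x))
      = exp (-(I * phase α u₀ x t z)) • gaugeInv α u₀ t z w x := by
    rw [gaugeInv, smul_smul, ← exp_add, neg_add_cancel, exp_zero, one_smul]
  rw [hsmul, smul_mulVec, mulVec_mulVec, hinv, one_mulVec]

theorem tendsto_mulVec {X m n : Type*} [Fintype n] {l : Filter X} {A : X → Matrix m n ℂ}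
    {y : X → n → ℂ} {B : Matrix m n ℂ} {v : n → ℂ} (hA : Tendsto A l (𝓝 B))
    (hy : Tendsto y l (𝓝 v)) : Tendsto (fun x => A x *ᵥ y x) l (𝓝 (B *ᵥ v)) :=
  tendsto_pi_nhds.2 fun i => tendsto_finsetSum _ fun j _ =>
    (tendsto_pi_nhds.1 (tendsto_pi_nhds.1 hA i) j).mul (tendsto_pi_nhds.1 hy j)

section JostColumn

variable {α u₀ t K ε : ℝ} {z um up : ℂ} {w : ℝ → ℂ}

namespace IsProfile

theorem isIntegrablePerturbation (h : IsProfile u₀ um up w) (hw : ∀ x, ‖w x‖ ≤ K)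
    (hbound : IsSpectralBound α u₀ K ε z) (him : (specK α u₀ z * specLam u₀ z).im ≤ 0) :
    IsIntegrablePerturbation ![0, 2 * (I * (specK α u₀ z * specLam u₀ z))]
      (gaugedResidual α u₀ z w) fun x => 8 * K ^ 6 * ε * residualDensity u₀ w x where
  re_nonneg i := by
    fin_cases i
    · exact le_rfl
    · have hre : (2 * (I * (specK α u₀ z * specLam u₀ z))).re
          = -2 * (specK α u₀ z * specLam u₀ z).im := by
        simp
        ring
      change 0 ≤ (2 * (I * (specK α u₀ z * specLam u₀ z))).re
      rw [hre]
      linarith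
  continuous_coeff :=
    ((continuous_expSigma3.comp (continuous_const.mul
      (continuous_ofReal.comp h.continuous_tailPhase))).matrix_mul
        (continuous_residual.comp (h.contDiff.continuous.prodMk h.continuous_deriv))).matrix_mul
      (continuous_expSigma3.comp (continuous_const.mul
        (continuous_ofReal.comp h.continuous_tailPhase)).neg)
  continuous_bound := by
    have := h.continuous_sq_sub_norm_sq
    have := h.continuous_deriv
    unfold residualDensity
    fun_prop
  bound_nonneg x := by
    have := hbound.nonneg
    unfold residualDensity
    positivity
  integrableOn_bound a :=
    ((h.integrable_sq_sub_norm_sq.abs.add h.integrable_deriv.norm).const_mul _).integrableOn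
  norm_mulVec_le x y := by
    have hentries (i j : Fin 2) : ‖gaugedResidual α u₀ z w x i j‖
        ≤ 4 * K ^ 6 * ε * residualDensity u₀ w x := by
      rw [norm_gaugedResidual_apply]
      exact hbound.norm_residual_le (hw x) i j
    refine (norm_mulVec_le_of_entries hentries ((norm_nonneg _).trans (hentries 0 0)) y).trans_eq ?_
    rw [Fintype.card_fin]
    push_cast
    ring

theorem tendsto_gauge_iff (h : IsProfile u₀ um up w) {φ : ℝ → Fin 2 → ℂ} :
    Tendsto (fun x => gauge α u₀ t z w x *ᵥ φ x) atTop (𝓝 ![1, 0]) ↔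
      Tendsto (fun x => expSigma3 (-(I * phase α u₀ x t z)) 0 0 • φ x) atTop
        (𝓝 fun i => eigY z up i 0) := by
  have htail : Tendsto (fun x => I * (tailPhase α u₀ w x : ℂ)) atTop (𝓝 0) := by
    simpa using! ((continuous_ofReal.tendsto 0).comp (tendsto_tailPhase α u₀ w)).const_mul I
  have hone : expSigma3 0 = 1 := by
    ext i j
    fin_cases i <;> fin_cases j <;> simp [expSigma3]
  have hexp : Tendsto (fun x => expSigma3 (I * tailPhase α u₀ w x)) atTop (𝓝 1) :=
    hone ▸ (continuous_expSigma3.tendsto 0).comp htail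
  have hexp_neg : Tendsto (fun x => expSigma3 (-(I * tailPhase α u₀ w x))) atTop (𝓝 1) :=
    hone ▸ (continuous_expSigma3.tendsto 0).comp (by simpa using htail.neg)
  have hright : diagonalizer u₀ z up *ᵥ (fun i => eigY z up i 0) = ![1, 0] := by
    rw [← diagonalizerInv_mulVec (u₀ := u₀), mulVec_mulVec, diagonalizer_mul_diagonalizerInv,
      one_mulVec]
  constructor
  · intro hφ
    have hmatrix := ((continuous_diagonalizerInv (u₀ := u₀) (z := z)).tendsto up).comp
      h.tendsto_right |>.mul hexp_neg
    rw [mul_one] at hmatrix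
    rw [← diagonalizerInv_mulVec (u₀ := u₀)]
    exact (tendsto_mulVec hmatrix hφ).congr fun x => exp_phase_smul_eq.symm
  · intro hφ
    have hmatrix := hexp.mul (((continuous_diagonalizer (u₀ := u₀) (z := z)).tendsto up).comp
      h.tendsto_right)
    rw [one_mul] at hmatrix
    rw [← hright]
    refine (tendsto_mulVec hmatrix hφ).congr fun x => ?_
    rw [gauge, smul_mulVec, ← mulVec_smul]
    rfl

end IsProfile

end JostColumn

section JostColumnZero

variable {α u₀ t x : ℝ} {z um up : ℂ} {u : ℝ → ℝ → ℂ} {F : Filter ℂ} {φ : ℂ → ℝ → Fin 2 → ℂ}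

namespace IsProfile

theorem isJostColumn_iff_gauge (h : IsProfile u₀ um up fun x => u x t) (hα : α ≠ 0) (hz : z ≠ 0)
    (hlam : specLam u₀ z ≠ 0) {φ : ℝ → Fin 2 → ℂ} :
    IsJostColumn atTop up α u₀ u 0 t z φ ↔
      (∀ x, HasDerivAt (fun y => gauge α u₀ t z (fun x => u x t) y *ᵥ φ y)
        ((diagonal ![0, 2 * (I * (specK α u₀ z * specLam u₀ z))]
            + gaugedResidual α u₀ z (fun x => u x t) x)
          *ᵥ (gauge α u₀ t z (fun x => u x t) x *ᵥ φ x)) x) ∧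
      Tendsto (fun x => gauge α u₀ t z (fun x => u x t) x *ᵥ φ x) atTop (𝓝 ![1, 0]) :=
  and_congr (forall_congr' fun _ => h.hasDerivAt_iff_gauge hα hz hlam) h.tendsto_gauge_iff.symm

theorem exists_isJostColumn_atTop_zero (h : IsProfile u₀ um up fun x => u x t) (hα : α ≠ 0)
    (hz : z ≠ 0) (hlam : specLam u₀ z ≠ 0) (him : (specK α u₀ z * specLam u₀ z).im ≤ 0) :
    ∃ φ, IsJostColumn atTop up α u₀ u 0 t z φ := by
  obtain ⟨L, hL⟩ := h.exists_bound
  obtain ⟨K, hbound, hLK⟩ :=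
    ((eventually_isSpectralBound α u₀ z).and (eventually_ge_atTop L)).exists
  obtain ⟨y, hy, hlim⟩ :=
    (h.isIntegrablePerturbation (fun x => (hL x).trans hLK) hbound him).exists_solution_tendsto
      zero_cons_mul_cons_zero
  refine ⟨fun x => gaugeInv α u₀ t z (fun x => u x t) x *ᵥ y x, ?_⟩
  simpa only [h.isJostColumn_iff_gauge hα hz hlam, mulVec_mulVec, gauge_mul_gaugeInv, one_mulVec]
    using ⟨hy, hlim⟩

/-! ### Asymptotics of the Jost columns at infinity -/

theorem isBigO_gauge_sub (h : IsProfile u₀ um up fun x => u x t) (hα : α ≠ 0)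
    (hF : F ≤ Bornology.cobounded ℂ) (him : ∀ᶠ z in F, (specK α u₀ z * specLam u₀ z).im ≤ 0)
    (hφ : ∀ᶠ z in F, IsJostColumn atTop up α u₀ u 0 t z (φ z)) :
    (fun z => gauge α u₀ t z (fun x => u x t) x *ᵥ φ z x - ![1, 0]) =O[F] fun z => z⁻¹ := by
  obtain ⟨L, hL⟩ := h.exists_bound
  obtain ⟨K, hbound, hLK⟩ :=
    ((eventually_isSpectralBound_cobounded α u₀).and (eventually_ge_atTop L)).exists
  set J := ∫ s in Set.Ioi x, residualDensity u₀ (fun x => u x t) s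
  have hsmall : ∀ᶠ z in Bornology.cobounded ℂ, 8 * K ^ 6 * (2 * ‖z⁻¹‖) * J ≤ 1 / 2 := by
    have hlim : Tendsto (fun z : ℂ => 8 * K ^ 6 * (2 * ‖z⁻¹‖) * J) (Bornology.cobounded ℂ)
        (𝓝 (8 * K ^ 6 * (2 * ‖(0 : ℂ)‖) * J)) :=
      ((tendsto_inv₀_cobounded.norm.const_mul 2).const_mul _).mul_const J
    exact hlim.eventually_le_const (by simp)
  refine .of_bound (2 * (8 * K ^ 6 * 2 * J)) ?_
  filter_upwards [him, hφ, hF hbound, hF hsmall,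
    hF (Bornology.le_cofinite ℂ (eventually_cofinite_specLam_ne_zero u₀))]
    with z him hφ hbound hsmall ⟨hz, hlam⟩
  obtain ⟨hode, hlim⟩ := (h.isJostColumn_iff_gauge hα hz hlam).1 hφ
  rw [← integral_const_mul] at hsmall
  refine ((h.isIntegrablePerturbation (fun x => (hL x).trans hLK) hbound him).norm_sub_le hode hlim
    zero_cons_mul_cons_zero hsmall).trans_eq ?_
  have hnorm : ‖(![1, 0] : Fin 2 → ℂ)‖ = 1 := by
    simp [Pi.norm_def, Fin.univ_succ]
  rw [integral_const_mul, hnorm]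
  ring

theorem isBigO_sub_single_atTop_zero (h : IsProfile u₀ um up fun x => u x t) (hα : α ≠ 0)
    (hF : F ≤ Bornology.cobounded ℂ) (him : ∀ᶠ z in F, (specK α u₀ z * specLam u₀ z).im ≤ 0)
    (hφ : ∀ᶠ z in F, IsJostColumn atTop up α u₀ u 0 t z (φ z)) :
    (fun z => expSigma3 (-(I * phase α u₀ x t z)) 0 0 • φ z x
      - Pi.single 0 (exp (-(I * tailPhase α u₀ (fun x => u x t) x)))) =O[F] fun z => z⁻¹ := by
  set N : ℂ := I * tailPhase α u₀ (fun x => u x t) x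
  set g : ℂ → Fin 2 → ℂ := fun z => gauge α u₀ t z (fun x => u x t) x *ᵥ φ z x
  have hinv : (fun z : ℂ => z⁻¹) =O[F] fun _ => (1 : ℂ) :=
    (tendsto_inv₀_cobounded.mono_left hF).isBigO_one ℂ
  have hB : (fun z => u x t / (2 * specLam u₀ z)) =O[F] fun z => z⁻¹ := by
    simp only [div_eq_mul_inv (u x t)]
    exact ((isBigO_inv_specLam u₀).mono hF).const_mul_left _
  have hs : (fun z => starRingEnd ℂ (u x t) / z) =O[F] fun z => z⁻¹ :=
    Asymptotics.isBigO_const_mul_self _ _ _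
  obtain ⟨hg₀, hg₁⟩ : (fun z => g z 0 - 1) =O[F] (fun z => z⁻¹) ∧
      (fun z => g z 1 - 0) =O[F] fun z => z⁻¹ :=
    Fin.forall_fin_two.1 (Asymptotics.isBigO_pi.1 (h.isBigO_gauge_sub hα hF him hφ))
  simp only [sub_zero] at hg₁
  have hg₀_one : (fun z => g z 0) =O[F] fun _ => (1 : ℂ) := by
    simpa using (hg₀.trans hinv).add (Asymptotics.isBigO_refl (fun _ : ℂ => (1 : ℂ)) F)
  have hmul {f₁ f₂ : ℂ → ℂ} (hf₁ : f₁ =O[F] fun z => z⁻¹) (hf₂ : f₂ =O[F] fun _ => (1 : ℂ)) :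
      (fun z => f₁ z * f₂ z) =O[F] fun z => z⁻¹ := by
    simpa using hf₁.mul hf₂
  have hfactor (z : ℂ) : expSigma3 (-(I * phase α u₀ x t z)) 0 0 • φ z x
      = diagonalizerInv u₀ z (u x t) *ᵥ (expSigma3 (-N) *ᵥ g z) := by
    rw [mulVec_mulVec]
    exact exp_phase_smul_eq (w := fun x => u x t)
  clear_value g
  refine Asymptotics.isBigO_pi.2 (Fin.forall_fin_two.2 ⟨?_, ?_⟩)
  · refine ((hg₀.const_mul_left (exp (-N))).add
      ((hmul hB (hg₁.trans hinv)).const_mul_left (exp N))).congr_left fun z => ?_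
    rw [Pi.sub_apply, hfactor]
    simp only [diagonalizerInv, expSigma3, mulVec, dotProduct, Fin.sum_univ_two, of_apply,
      cons_val', cons_val_zero, cons_val_one, cons_val_fin_one, neg_neg, Pi.single_eq_same]
    ring
  · refine (((hmul hs hg₀_one).const_mul_left (-exp (-N))).add
      ((hg₁.sub (hmul hs ((hmul hB (hg₁.trans hinv)).trans hinv))).const_mul_left
        (exp N))).congr_left fun z => ?_
    rw [Pi.sub_apply, hfactor]
    simp only [diagonalizerInv, expSigma3, mulVec, dotProduct, Fin.sum_univ_two, of_apply,
      cons_val', cons_val_zero, cons_val_one, cons_val_fin_one, neg_neg,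
      Pi.single_eq_of_ne one_ne_zero]
    ring

end IsProfile

end JostColumnZero


/-! ### Symmetries of the Jost columns -/

section Symmetry

variable {α u₀ t : ℝ} {z v w : ℂ} {u : ℝ → ℝ → ℂ} {l : Filter ℝ} {j : Fin 2} {φ : ℝ → Fin 2 → ℂ}

theorem expSigma3_neg_rev (a : ℂ) (j : Fin 2) : expSigma3 (-a) j.rev j.rev = expSigma3 a j j := by
  fin_cases j <;> simp [expSigma3]

theorem expSigma3_conj (a : ℂ) (i j : Fin 2) :
    expSigma3 (starRingEnd ℂ a) i j = starRingEnd ℂ (expSigma3 a i j) := by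
  fin_cases i <;> fin_cases j <;> simp [expSigma3, ← exp_conj]

theorem eigY_apply_self (z v : ℂ) (j : Fin 2) : eigY z v j j = 1 := by
  fin_cases j <;> simp [eigY, sigma3, potQ]

theorem eigY_zero_one (z v : ℂ) : eigY z v 0 1 = z⁻¹ * v := by
  simp [eigY, sigma3, potQ]

theorem eigY_one_zero (z v : ℂ) : eigY z v 1 0 = -(z⁻¹ * starRingEnd ℂ v) := by
  simp [eigY, sigma3, potQ]

theorem specK_neg_conj : specK α u₀ (-starRingEnd ℂ z) = -starRingEnd ℂ (specK α u₀ z) := by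
  simp only [specK, map_sub, map_div₀, map_mul, map_pow, map_ofNat, conj_ofReal]
  ring

theorem specLam_neg_conj : specLam u₀ (-starRingEnd ℂ z) = -starRingEnd ℂ (specLam u₀ z) := by
  simp only [specLam, map_add, map_div₀, map_pow, map_ofNat, conj_ofReal]
  ring

theorem phase_neg_conj (x : ℝ) :
    phase α u₀ x t (-starRingEnd ℂ z) = starRingEnd ℂ (phase α u₀ x t z) := by
  simp [phase, specK_neg_conj, specLam_neg_conj, map_ofNat]

theorem laxX_neg_conj (i j : Fin 2) :
    laxX α u₀ (-starRingEnd ℂ z) w i j = starRingEnd ℂ (laxX α u₀ z w i.rev j.rev) := by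
  fin_cases i <;> fin_cases j <;> simp [laxX_eq, specK_neg_conj]

theorem eigY_neg_conj (i j : Fin 2) :
    eigY (-starRingEnd ℂ z) v i j = starRingEnd ℂ (eigY z v i.rev j.rev) := by
  fin_cases i <;> fin_cases j <;> simp [eigY, sigma3, potQ, inv_neg]

/-- The vector function with the conjugate components in exchanged order. -/
def swapConj (φ : ℝ → Fin 2 → ℂ) (x : ℝ) (i : Fin 2) : ℂ := starRingEnd ℂ (φ x i.rev)

theorem IsJostColumn.swapConj (h : IsJostColumn l v α u₀ u j t z φ) :
    IsJostColumn l v α u₀ u j.rev t (-starRingEnd ℂ z) (swapConj φ) := by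
  refine ⟨fun x => hasDerivAt_pi.2 fun i => ?_, tendsto_pi_nhds.2 fun i => ?_⟩
  · refine (hasDerivAt_pi.1 (h.1 x) i.rev).star.congr_deriv ?_
    rw [← starRingEnd_apply, mulVec, mulVec, dotProduct, dotProduct, map_sum]
    simp only [map_mul, laxX_neg_conj, MNLS.swapConj]
    exact (Equiv.sum_comp Fin.revPerm _).symm
  · have hconj := (continuous_conj.tendsto _).comp (tendsto_pi_nhds.1 h.2 i.rev)
    rw [eigY_neg_conj, Fin.rev_rev]
    refine hconj.congr fun x => ?_
    simp [MNLS.swapConj, phase_neg_conj, ← expSigma3_conj, ← expSigma3_neg_rev (I * _)]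

theorem specK_inversion (hu₀ : u₀ ≠ 0) : specK α u₀ (-(u₀ ^ 2 / z)) = specK α u₀ z := by
  have : (u₀ : ℂ) ≠ 0 := ofReal_ne_zero.2 hu₀
  by_cases hz : z = 0
  · simp [specK, hz]
  unfold specK
  congr 1
  field_simp
  ring

theorem specLam_inversion (hu₀ : u₀ ≠ 0) : specLam u₀ (-(u₀ ^ 2 / z)) = -specLam u₀ z := by
  have : (u₀ : ℂ) ≠ 0 := ofReal_ne_zero.2 hu₀
  by_cases hz : z = 0
  · simp [specLam, hz]
  unfold specLam
  field_simp
  ring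

theorem phase_inversion (hu₀ : u₀ ≠ 0) (x : ℝ) :
    phase α u₀ x t (-(u₀ ^ 2 / z)) = -phase α u₀ x t z := by
  rw [phase, phase, specK_inversion hu₀, specLam_inversion hu₀]
  ring

theorem gam_inversion (hu₀ : u₀ ≠ 0) (hz : z ≠ 0) :
    gam u₀ (-(u₀ ^ 2 / z)) = z ^ 2 / u₀ ^ 2 * gam u₀ z := by
  have : (u₀ : ℂ) ≠ 0 := ofReal_ne_zero.2 hu₀
  unfold gam
  field_simp
  ring

theorem eigY_inversion (hu₀ : u₀ ≠ 0) (hz : z ≠ 0) (hv : ‖v‖ = u₀) (i j : Fin 2) :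
    eigY (-(u₀ ^ 2 / z)) v i j.rev = eigY (-(u₀ ^ 2 / z)) v j j.rev * eigY z v i j := by
  have hu₀' : (u₀ : ℂ) ≠ 0 := ofReal_ne_zero.2 hu₀
  have hvv : v * starRingEnd ℂ v = (u₀ : ℂ) ^ 2 := by rw [mul_conj', hv]
  fin_cases i <;> fin_cases j <;> simp [eigY, sigma3, potQ] <;> field_simp <;>
    linear_combination -hvv

theorem IsJostColumn.inversion (hu₀ : u₀ ≠ 0) (hz : z ≠ 0) (hv : ‖v‖ = u₀)
    (h : IsJostColumn l v α u₀ u j t z φ) :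
    IsJostColumn l v α u₀ u j.rev t (-(u₀ ^ 2 / z))
      (fun x => eigY (-(u₀ ^ 2 / z)) v j j.rev • φ x) := by
  set c := eigY (-(u₀ ^ 2 / z)) v j j.rev
  refine ⟨fun x => ((h.1 x).const_smul c).congr_deriv ?_, ?_⟩
  · simp only [laxX, specK_inversion hu₀, mulVec_smul]
  · have hlim : (fun i => eigY (-(u₀ ^ 2 / z)) v i j.rev) = c • fun i => eigY z v i j :=
      funext fun i => eigY_inversion hu₀ hz hv i j
    rw [hlim]
    refine (h.2.const_smul c).congr fun x => ?_
    rw [phase_inversion hu₀, mul_neg, expSigma3_neg_rev, smul_comm]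

/-- The potential reflected in space and time. The reflection interchanges the two ends of the line
and the two columns of the Jost solutions. -/
def reflectedPotential (u : ℝ → ℝ → ℂ) (x t : ℝ) : ℂ := -starRingEnd ℂ (u (-x) (-t))

/-- The reflected vector function with components in exchanged order. -/
def swapNeg (φ : ℝ → Fin 2 → ℂ) (x : ℝ) (i : Fin 2) : ℂ := φ (-x) i.rev

theorem reflectedPotential_reflectedPotential : reflectedPotential (reflectedPotential u) = u := by
  funext x t
  simp [reflectedPotential]

theorem phase_neg (x : ℝ) : phase α u₀ x (-t) z = -phase α u₀ (-x) t z := by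
  simp only [phase, ofReal_neg]
  ring

theorem laxX_neg_conj_potential (i j : Fin 2) :
    laxX α u₀ z (-starRingEnd ℂ w) i j = -laxX α u₀ z w i.rev j.rev := by
  fin_cases i <;> fin_cases j <;> simp [laxX_eq]

theorem eigY_neg_conj_potential (i j : Fin 2) :
    eigY z (-starRingEnd ℂ v) i j = eigY z v i.rev j.rev := by
  fin_cases i <;> fin_cases j <;> simp [eigY, sigma3, potQ]

theorem IsJostColumn.swapNeg {l' : Filter ℝ} (hl : Tendsto Neg.neg l' l)
    (h : IsJostColumn l v α u₀ u j t z φ) :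
    IsJostColumn l' (-starRingEnd ℂ v) α u₀ (reflectedPotential u) j.rev (-t) z (swapNeg φ) := by
  refine ⟨fun x => hasDerivAt_pi.2 fun i => ?_, tendsto_pi_nhds.2 fun i => ?_⟩
  · refine ((hasDerivAt_pi.1 (h.1 (-x)) i.rev).scomp x (hasDerivAt_neg x)).congr_deriv ?_
    rw [mulVec, mulVec, dotProduct, dotProduct, reflectedPotential, neg_neg]
    simp only [laxX_neg_conj_potential, MNLS.swapNeg, neg_smul, one_smul, neg_mul,
      Finset.sum_neg_distrib]
    exact congr_arg Neg.neg (Equiv.sum_comp Fin.revPerm _).symm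
  · rw [eigY_neg_conj_potential, Fin.rev_rev]
    refine (((tendsto_pi_nhds.1 h.2) i.rev).comp hl).congr fun x => ?_
    simp [MNLS.swapNeg, phase_neg, ← expSigma3_neg_rev (-(I * _))]

theorem IsProfile.reflectedPotential {um up : ℂ} (h : IsProfile u₀ um up fun x => u x t) :
    IsProfile u₀ (-starRingEnd ℂ up) (-starRingEnd ℂ um)
      fun x => reflectedPotential u x (-t) := by
  simpa only [MNLS.reflectedPotential, neg_neg] using h.reflect

theorem im_specK_mul_specLam_neg_conj :
    (specK α u₀ (-starRingEnd ℂ z) * specLam u₀ (-starRingEnd ℂ z)).im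
      = -(specK α u₀ z * specLam u₀ z).im := by
  rw [specK_neg_conj, specLam_neg_conj, neg_mul_neg, ← map_mul, conj_im]

theorem specLam_neg_conj_ne_zero (hlam : specLam u₀ z ≠ 0) :
    specLam u₀ (-starRingEnd ℂ z) ≠ 0 := by
  rw [specLam_neg_conj]
  exact neg_ne_zero.2 ((map_ne_zero _).2 hlam)

end Symmetry

/-! ### Existence of the Jost columns -/

section Existence

variable {α u₀ t : ℝ} {z um up : ℂ} {u : ℝ → ℝ → ℂ}

namespace IsProfile

theorem exists_isJostColumn_atBot_one (h : IsProfile u₀ um up fun x => u x t) (hα : α ≠ 0)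
    (hz : z ≠ 0) (hlam : specLam u₀ z ≠ 0) (him : (specK α u₀ z * specLam u₀ z).im ≤ 0) :
    ∃ φ, IsJostColumn atBot um α u₀ u 1 t z φ := by
  obtain ⟨φ, hφ⟩ := h.reflectedPotential.exists_isJostColumn_atTop_zero hα hz hlam him
  have hreflect := hφ.swapNeg tendsto_neg_atBot_atTop
  simp only [reflectedPotential_reflectedPotential, map_neg, conj_conj, neg_neg] at hreflect
  exact ⟨_, hreflect⟩

theorem exists_isJostColumn_atTop_one (h : IsProfile u₀ um up fun x => u x t) (hα : α ≠ 0)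
    (hz : z ≠ 0) (hlam : specLam u₀ z ≠ 0) (him : 0 ≤ (specK α u₀ z * specLam u₀ z).im) :
    ∃ φ, IsJostColumn atTop up α u₀ u 1 t z φ := by
  obtain ⟨φ, hφ⟩ := h.exists_isJostColumn_atTop_zero (z := -starRingEnd ℂ z) hα (by simpa using hz)
    (specLam_neg_conj_ne_zero hlam) (by rw [im_specK_mul_specLam_neg_conj]; linarith)
  exact ⟨_, by simpa only [map_neg, conj_conj, neg_neg] using! hφ.swapConj⟩

theorem exists_isJostColumn_atBot_zero (h : IsProfile u₀ um up fun x => u x t) (hα : α ≠ 0)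
    (hz : z ≠ 0) (hlam : specLam u₀ z ≠ 0) (him : 0 ≤ (specK α u₀ z * specLam u₀ z).im) :
    ∃ φ, IsJostColumn atBot um α u₀ u 0 t z φ := by
  obtain ⟨φ, hφ⟩ := h.exists_isJostColumn_atBot_one (z := -starRingEnd ℂ z) hα (by simpa using hz)
    (specLam_neg_conj_ne_zero hlam) (by rw [im_specK_mul_specLam_neg_conj]; linarith)
  exact ⟨_, by simpa only [map_neg, conj_conj, neg_neg] using! hφ.swapConj⟩

end IsProfile

theorem isJostColumn_jostColumn {l : Filter ℝ} {v : ℂ} {j : Fin 2}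
    (h : ∃ φ, IsJostColumn l v α u₀ u j t z φ) :
    IsJostColumn l v α u₀ u j t z fun x => jostColumn l v α u₀ u j x t z := by
  convert h.choose_spec using 1
  funext x
  rw [jostColumn, dif_pos h]

end Existence


section SymmetryAsymptotics

variable {α u₀ t x : ℝ} {z c : ℂ} {F : Filter ℂ} {j : Fin 2} {φ : ℂ → ℝ → Fin 2 → ℂ}

theorem isBigO_sub_single_swapConj
    (h : (fun z => expSigma3 (-(I * phase α u₀ x t z)) j j • swapConj (φ (-starRingEnd ℂ z)) x
      - Pi.single j c) =O[map (fun z => -starRingEnd ℂ z) F] fun z => z⁻¹) :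
    (fun z => expSigma3 (-(I * phase α u₀ x t z)) j.rev j.rev • φ z x
      - Pi.single j.rev (starRingEnd ℂ c)) =O[F] fun z => z⁻¹ := by
  rw [Asymptotics.isBigO_map] at h
  refine Asymptotics.isBigO_pi.2 fun i => Asymptotics.isBigO_norm_norm.1
    ((Asymptotics.isBigO_pi.1 h i.rev).norm_norm.congr (fun z => ?_) fun z => by simp)
  rw [← RCLike.norm_conj]
  simp [swapConj, phase_neg_conj, ← expSigma3_conj, ← expSigma3_neg_rev (-(I * _)),
    Pi.single_apply, Fin.rev_eq_iff, apply_ite (starRingEnd ℂ)]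

theorem isBigO_sub_single_swapNeg
    (h : (fun z => expSigma3 (-(I * phase α u₀ (-x) (-t) z)) j j • swapNeg (φ z) (-x)
      - Pi.single j c) =O[F] fun z => z⁻¹) :
    (fun z => expSigma3 (-(I * phase α u₀ x t z)) j.rev j.rev • φ z x
      - Pi.single j.rev c) =O[F] fun z => z⁻¹ := by
  refine Asymptotics.isBigO_pi.2 fun i => (Asymptotics.isBigO_pi.1 h i.rev).congr_left fun z => ?_
  simp [swapNeg, phase_neg, ← expSigma3_neg_rev (-(I * _)), Pi.single_apply, Fin.rev_eq_iff]

end SymmetryAsymptotics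

section ColumnAsymptotics

variable {α u₀ t x : ℝ} {um up : ℂ} {u : ℝ → ℝ → ℂ} {F : Filter ℂ} {φ : ℂ → ℝ → Fin 2 → ℂ}

theorem tendsto_neg_conj_cobounded :
    Tendsto (fun z => -starRingEnd ℂ z) (Bornology.cobounded ℂ) (Bornology.cobounded ℂ) := by
  simpa only [tendsto_norm_atTop_iff_cobounded.symm, norm_neg, RCLike.norm_conj]
    using tendsto_norm_cobounded_atTop

namespace IsProfile

theorem tailPhase_reflectedPotential (h : IsProfile u₀ um up fun x => u x t) (x : ℝ) :
    tailPhase α u₀ (fun x => MNLS.reflectedPotential u x (-t)) (-x)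
      = nu0 α u₀ u t - tailPhase α u₀ (fun x => u x t) x := by
  simpa only [MNLS.reflectedPotential, neg_neg]
    using eq_sub_of_add_eq' (h.tailPhase_add_tailPhase_reflect x)

theorem isBigO_sub_single_atTop_one (h : IsProfile u₀ um up fun x => u x t) (hα : α ≠ 0)
    (hF : F ≤ Bornology.cobounded ℂ) (him : ∀ᶠ z in F, 0 ≤ (specK α u₀ z * specLam u₀ z).im)
    (hφ : ∀ᶠ z in F, IsJostColumn atTop up α u₀ u 1 t z (φ z)) :
    (fun z => expSigma3 (-(I * phase α u₀ x t z)) 1 1 • φ z x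
      - Pi.single 1 (exp (I * tailPhase α u₀ (fun x => u x t) x))) =O[F] fun z => z⁻¹ := by
  have hzero := h.isBigO_sub_single_atTop_zero (x := x) (F := map (fun z => -starRingEnd ℂ z) F)
    (φ := fun z => swapConj (φ (-starRingEnd ℂ z))) hα (tendsto_neg_conj_cobounded.mono_left hF)
    (eventually_map.2 (him.mono fun z hz => by rw [im_specK_mul_specLam_neg_conj]; linarith))
    (eventually_map.2 (hφ.mono fun z hz => by
      simpa only [map_neg, conj_conj, neg_neg] using! hz.swapConj))
  simpa [← Complex.exp_conj] using! isBigO_sub_single_swapConj hzero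

theorem isBigO_sub_single_atBot_one (h : IsProfile u₀ um up fun x => u x t) (hα : α ≠ 0)
    (hF : F ≤ Bornology.cobounded ℂ) (him : ∀ᶠ z in F, (specK α u₀ z * specLam u₀ z).im ≤ 0)
    (hφ : ∀ᶠ z in F, IsJostColumn atBot um α u₀ u 1 t z (φ z)) :
    (fun z => expSigma3 (-(I * phase α u₀ x t z)) 1 1 • φ z x
      - Pi.single 1 (exp (-(I * (nu0 α u₀ u t - tailPhase α u₀ (fun x => u x t) x)))))
      =O[F] fun z => z⁻¹ := by
  have hswap : ∀ᶠ z in F, IsJostColumn atTop (-starRingEnd ℂ um) α u₀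
      (MNLS.reflectedPotential u) 0 (-t) z (swapNeg (φ z)) :=
    hφ.mono fun z hz => (hz.swapNeg tendsto_neg_atTop_atBot :)
  have hzero := h.reflectedPotential.isBigO_sub_single_atTop_zero (x := -x) hα hF him hswap
  rw [h.tailPhase_reflectedPotential, ofReal_sub] at hzero
  exact isBigO_sub_single_swapNeg hzero

theorem isBigO_sub_single_atBot_zero (h : IsProfile u₀ um up fun x => u x t) (hα : α ≠ 0)
    (hF : F ≤ Bornology.cobounded ℂ) (him : ∀ᶠ z in F, 0 ≤ (specK α u₀ z * specLam u₀ z).im)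
    (hφ : ∀ᶠ z in F, IsJostColumn atBot um α u₀ u 0 t z (φ z)) :
    (fun z => expSigma3 (-(I * phase α u₀ x t z)) 0 0 • φ z x
      - Pi.single 0 (exp (I * (nu0 α u₀ u t - tailPhase α u₀ (fun x => u x t) x))))
      =O[F] fun z => z⁻¹ := by
  have hone := h.isBigO_sub_single_atBot_one (x := x) (F := map (fun z => -starRingEnd ℂ z) F)
    (φ := fun z => swapConj (φ (-starRingEnd ℂ z))) hα (tendsto_neg_conj_cobounded.mono_left hF)
    (eventually_map.2 (him.mono fun z hz => by rw [im_specK_mul_specLam_neg_conj]; linarith))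
    (eventually_map.2 (hφ.mono fun z hz => by
      simpa only [map_neg, conj_conj, neg_neg] using! hz.swapConj))
  simpa [← Complex.exp_conj] using! isBigO_sub_single_swapConj hone

end IsProfile

end ColumnAsymptotics

/-! ### Asymptotics of the Wronskians -/

section Wronskian

theorem isBigO_mul_sub_mul {X : Type*} {F : Filter X} {f h g : X → ℂ} {a b : ℂ}
    (hf : (fun y => f y - a) =O[F] g) (hh : (fun y => h y - b) =O[F] g)
    (hg : g =O[F] fun _ => (1 : ℂ)) : (fun y => f y * h y - a * b) =O[F] g := by
  have hh_one : h =O[F] fun _ => (1 : ℂ) := by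
    simpa using (hh.trans hg).add (Asymptotics.isBigO_const_const b one_ne_zero F)
  refine (((hf.mul hh_one).congr_right fun y => mul_one _).add
    (hh.const_mul_left a)).congr_left fun y => ?_
  ring

theorem isBigO_wronskian_sub_wronskian {X : Type*} {F : Filter X} {a b : X → Fin 2 → ℂ}
    {a₀ b₀ : Fin 2 → ℂ} {g : X → ℂ} (ha : (fun y => a y - a₀) =O[F] g)
    (hb : (fun y => b y - b₀) =O[F] g) (hg : g =O[F] fun _ => (1 : ℂ)) :
    (fun y => wronskian (a y) (b y) - wronskian a₀ b₀) =O[F] g := by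
  rw [Asymptotics.isBigO_pi] at ha hb
  refine ((isBigO_mul_sub_mul (ha 0) (hb 1) hg).sub
    (isBigO_mul_sub_mul (ha 1) (hb 0) hg)).congr_left fun y => ?_
  simp only [wronskian]
  ring

theorem wronskian_smul_smul (c d : ℂ) (a b : Fin 2 → ℂ) :
    wronskian (c • a) (d • b) = c * d * wronskian a b := by
  simp only [wronskian, Pi.smul_apply, smul_eq_mul]
  ring

theorem isBigO_div_gam_sub {F : Filter ℂ} {W : ℂ → ℂ} {c : ℂ} (u₀ : ℝ)
    (hF : F ≤ Bornology.cobounded ℂ) (hW : (fun z => W z - c) =O[F] fun z => z⁻¹) :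
    (fun z => W z / gam u₀ z - c) =O[F] fun z => z⁻¹ := by
  have hinv : (fun z : ℂ => z⁻¹) =O[F] fun _ => (1 : ℂ) :=
    (tendsto_inv₀_cobounded.mono_left hF).isBigO_one ℂ
  have hgam : Tendsto (gam u₀) F (𝓝 1) := (tendsto_gam u₀).mono_left hF
  have hgam_sub : (fun z => gam u₀ z - 1) =O[F] fun z => z⁻¹ := by
    refine ((isBigO_gam_sub_one u₀).mono hF).trans ?_
    simpa only [pow_two, mul_one] using (Asymptotics.isBigO_refl (fun z : ℂ => z⁻¹) F).mul hinv
  have hnum : (fun z => W z - c - c * (gam u₀ z - 1)) =O[F] fun z => z⁻¹ :=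
    hW.sub (hgam_sub.const_mul_left c)
  refine ((hnum.mul ((hgam.inv₀ one_ne_zero).isBigO_one ℂ)).congr_right
    fun z => mul_one _).congr' ?_ .rfl
  filter_upwards [hgam.eventually_ne one_ne_zero] with z hz
  field_simp
  ring

end Wronskian

section WronskianAsymptotics

variable {α u₀ t : ℝ} {um up : ℂ} {u : ℝ → ℝ → ℂ} {F : Filter ℂ} {φ ψ : ℂ → ℝ → Fin 2 → ℂ}

theorem wronskian_expSigma3_smul (a : ℂ) (y y' : Fin 2 → ℂ) :
    wronskian (expSigma3 a 0 0 • y) (expSigma3 a 1 1 • y') = wronskian y y' := by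
  rw [wronskian_smul_smul]
  simp [expSigma3, ← exp_add]

theorem wronskian_single_zero_single_one (a b : ℂ) :
    wronskian (Pi.single 0 a) (Pi.single 1 b) = a * b := by
  simp [wronskian]

theorem norm_expSigma3_of_mem_contour {z : ℂ} (hz : z ∈ contour) (x : ℝ) (j : Fin 2) :
    ‖expSigma3 (-(I * phase α u₀ x t z)) j j‖ = 1 := by
  have hreal : starRingEnd ℂ (phase α u₀ x t z) = phase α u₀ x t z := by
    rcases mul_eq_zero.1 hz.1 with hre | him
    · have hconj : -starRingEnd ℂ z = z := by
        apply Complex.ext <;> simp [hre]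
      rw [← phase_neg_conj, hconj]
    · have hconj : starRingEnd ℂ z = z := conj_eq_iff_im.2 him
      simp [phase, specK, specLam, hconj, map_ofNat]
  rw [← conj_eq_iff_re.1 hreal]
  fin_cases j
  · simpa [expSigma3] using norm_exp_I_mul_ofReal (-(phase α u₀ x t z).re)
  · simp [expSigma3]

theorem im_specK_mul_specLam_of_mem_contour {z : ℂ} (hz : z ∈ contour) :
    (specK α u₀ z * specLam u₀ z).im = 0 := by
  rw [im_specK_mul_specLam hz.2, hz.1, zero_mul]

namespace IsProfile

theorem isBigO_wronskian_atTop_zero_atBot_one_of_le_cobounded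
    (h : IsProfile u₀ um up fun x => u x t) (hα : α ≠ 0)
    (hF : F ≤ Bornology.cobounded ℂ) (him : ∀ᶠ z in F, (specK α u₀ z * specLam u₀ z).im ≤ 0)
    (hφ : ∀ᶠ z in F, IsJostColumn atTop up α u₀ u 0 t z (φ z))
    (hψ : ∀ᶠ z in F, IsJostColumn atBot um α u₀ u 1 t z (ψ z)) (x : ℝ) :
    (fun z => wronskian (φ z x) (ψ z x) / gam u₀ z - exp (-(I * nu0 α u₀ u t)))
      =O[F] fun z => z⁻¹ := by
  have hW := isBigO_wronskian_sub_wronskian (h.isBigO_sub_single_atTop_zero (x := x) hα hF him hφ)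
    (h.isBigO_sub_single_atBot_one (x := x) hα hF him hψ)
    ((tendsto_inv₀_cobounded.mono_left hF).isBigO_one ℂ)
  simp only [wronskian_expSigma3_smul, wronskian_single_zero_single_one, ← exp_add] at hW
  refine isBigO_div_gam_sub u₀ hF ?_
  convert hW using 4
  ring

theorem isBigO_wronskian_atBot_zero_atTop_one_of_le_cobounded
    (h : IsProfile u₀ um up fun x => u x t) (hα : α ≠ 0)
    (hF : F ≤ Bornology.cobounded ℂ) (him : ∀ᶠ z in F, 0 ≤ (specK α u₀ z * specLam u₀ z).im)
    (hφ : ∀ᶠ z in F, IsJostColumn atBot um α u₀ u 0 t z (φ z))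
    (hψ : ∀ᶠ z in F, IsJostColumn atTop up α u₀ u 1 t z (ψ z)) (x : ℝ) :
    (fun z => wronskian (φ z x) (ψ z x) / gam u₀ z - exp (I * nu0 α u₀ u t))
      =O[F] fun z => z⁻¹ := by
  have hW := isBigO_wronskian_sub_wronskian (h.isBigO_sub_single_atBot_zero (x := x) hα hF him hφ)
    (h.isBigO_sub_single_atTop_one (x := x) hα hF him hψ)
    ((tendsto_inv₀_cobounded.mono_left hF).isBigO_one ℂ)
  simp only [wronskian_expSigma3_smul, wronskian_single_zero_single_one, ← exp_add] at hW
  refine isBigO_div_gam_sub u₀ hF ?_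
  convert hW using 4
  ring

theorem isBigO_wronskian_same_column_of_le_cobounded
    (h : IsProfile u₀ um up fun x => u x t) (hα : α ≠ 0)
    (hF : F ≤ Bornology.cobounded ℂ) (hcontour : ∀ᶠ z in F, z ∈ contour) {j : Fin 2}
    (hφ : ∀ᶠ z in F, IsJostColumn atTop up α u₀ u j t z (φ z))
    (hψ : ∀ᶠ z in F, IsJostColumn atBot um α u₀ u j t z (ψ z)) (x : ℝ) :
    (fun z => wronskian (φ z x) (ψ z x) / gam u₀ z) =O[F] fun z => z⁻¹ := by
  have him := hcontour.mono fun z => im_specK_mul_specLam_of_mem_contour (α := α) (u₀ := u₀)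
  obtain ⟨a, b, ha, hb⟩ : ∃ a b, (fun z => expSigma3 (-(I * phase α u₀ x t z)) j j • φ z x
      - Pi.single j a) =O[F] (fun z => z⁻¹) ∧ (fun z => expSigma3 (-(I * phase α u₀ x t z)) j j
      • ψ z x - Pi.single j b) =O[F] fun z => z⁻¹ := by
    have hle := him.mono fun z hz => hz.le
    have hge := him.mono fun z hz => hz.ge
    fin_cases j
    · exact ⟨_, _, h.isBigO_sub_single_atTop_zero hα hF hle hφ,
        h.isBigO_sub_single_atBot_zero hα hF hge hψ⟩
    · exact ⟨_, _, h.isBigO_sub_single_atTop_one hα hF hge hφ,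
        h.isBigO_sub_single_atBot_one hα hF hle hψ⟩
  have hsingle : wronskian (Pi.single j a) (Pi.single j b) = 0 := by
    fin_cases j <;> simp [wronskian]
  have hW := isBigO_wronskian_sub_wronskian ha hb
    ((tendsto_inv₀_cobounded.mono_left hF).isBigO_one ℂ)
  rw [hsingle] at hW
  simp only [sub_zero] at hW
  suffices hW' : (fun z => wronskian (φ z x) (ψ z x) - 0) =O[F] fun z => z⁻¹ by
    simpa only [sub_zero] using isBigO_div_gam_sub u₀ hF hW'
  refine Asymptotics.isBigO_norm_left.1 (hW.norm_left.congr' ?_ .rfl)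
  filter_upwards [hcontour] with z hz
  rw [wronskian_smul_smul, norm_mul, norm_mul, norm_expSigma3_of_mem_contour hz, one_mul, one_mul,
    sub_zero]

end IsProfile

end WronskianAsymptotics


/-! ### Asymptotics at the origin -/

section Inversion

variable {α u₀ t : ℝ} {z v v' c : ℂ} {l : Filter ℝ} {u : ℝ → ℝ → ℂ} {j : Fin 2} {x : ℝ}
  {F : Filter ℂ} {φ ψ : ℂ → ℝ → Fin 2 → ℂ}

theorem wronskian_comm (a b : Fin 2 → ℂ) : wronskian a b = -wronskian b a := by
  simp only [wronskian]
  ring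

theorem inversion_inversion (hu₀ : u₀ ≠ 0) (z : ℂ) :
    -((u₀ : ℂ) ^ 2 / -((u₀ : ℂ) ^ 2 / z)) = z := by
  rw [div_neg, neg_neg, div_div_cancel₀ (pow_ne_zero 2 (ofReal_ne_zero.2 hu₀))]

theorem tendsto_inversion_cobounded (hu₀ : u₀ ≠ 0) :
    Tendsto (fun z : ℂ => -((u₀ : ℂ) ^ 2 / z)) (𝓝[≠] 0) (Bornology.cobounded ℂ) := by
  simp only [div_eq_mul_inv, ← neg_mul]
  exact (tendsto_mul_left_cobounded (neg_ne_zero.2 (pow_ne_zero 2 (ofReal_ne_zero.2 hu₀)))).comp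
    tendsto_inv₀_nhdsNE_zero

theorem im_specK_mul_specLam_inversion (hu₀ : u₀ ≠ 0) :
    (specK α u₀ (-((u₀ : ℂ) ^ 2 / z)) * specLam u₀ (-((u₀ : ℂ) ^ 2 / z))).im
      = -(specK α u₀ z * specLam u₀ z).im := by
  rw [specK_inversion hu₀, specLam_inversion hu₀, mul_neg, neg_im]

theorem inversion_mem_contour (hu₀ : u₀ ≠ 0) (hz : z ∈ contour) :
    -((u₀ : ℂ) ^ 2 / z) ∈ contour := by
  refine ⟨?_, neg_ne_zero.2 (div_ne_zero (pow_ne_zero 2 (ofReal_ne_zero.2 hu₀)) hz.2)⟩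
  rw [← ofReal_pow, div_eq_mul_inv, neg_re, neg_im, re_ofReal_mul, im_ofReal_mul, inv_re, inv_im]
  linear_combination -(u₀ ^ 2 / normSq z) ^ 2 * hz.1

/-- The family of Jost columns with opposite index that the symmetry `z ↦ -u₀² / z` makes out of
a family `φ` of `j`-th Jost columns with boundary value `v`. -/
noncomputable def invertColumn (u₀ : ℝ) (v : ℂ) (j : Fin 2) (φ : ℂ → ℝ → Fin 2 → ℂ) (z : ℂ)
    (x : ℝ) : Fin 2 → ℂ :=
  eigY z v j j.rev • φ (-((u₀ : ℂ) ^ 2 / z)) x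

theorem invertColumn_inversion (hu₀ : u₀ ≠ 0) :
    invertColumn u₀ v j φ (-((u₀ : ℂ) ^ 2 / z)) x
      = eigY (-((u₀ : ℂ) ^ 2 / z)) v j j.rev • φ z x := by
  rw [invertColumn, inversion_inversion hu₀]

theorem eventually_isJostColumn_invertColumn (hu₀ : u₀ ≠ 0) (hv : ‖v‖ = u₀) (hF : F ≤ 𝓝[≠] 0)
    (hφ : ∀ᶠ z in F, IsJostColumn l v α u₀ u j t z (φ z)) :
    ∀ᶠ z in map (fun z : ℂ => -((u₀ : ℂ) ^ 2 / z)) F,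
      IsJostColumn l v α u₀ u j.rev t z (invertColumn u₀ v j φ z) := by
  refine eventually_map.2 ?_
  filter_upwards [hφ, hF self_mem_nhdsWithin] with z hφz hz
  convert hφz.inversion hu₀ hz hv using 1
  exact funext fun x => invertColumn_inversion hu₀

theorem wronskian_invertColumn (hu₀ : u₀ ≠ 0) (hz : z ≠ 0) (hv' : ‖v'‖ = u₀) :
    wronskian (invertColumn u₀ v' 1 ψ (-((u₀ : ℂ) ^ 2 / z)) x)
        (invertColumn u₀ v 0 φ (-((u₀ : ℂ) ^ 2 / z)) x) / gam u₀ (-((u₀ : ℂ) ^ 2 / z))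
      = v / v' * (wronskian (φ z x) (ψ z x) / gam u₀ z) := by
  have hu : (u₀ : ℂ) ≠ 0 := ofReal_ne_zero.2 hu₀
  have hv0 : v' ≠ 0 := norm_ne_zero_iff.1 (hv' ▸ hu₀)
  have hconj : starRingEnd ℂ v' = (u₀ : ℂ) ^ 2 / v' := by
    rw [eq_div_iff hv0, conj_mul', hv']
  rw [invertColumn_inversion hu₀, invertColumn_inversion hu₀, wronskian_smul_smul,
    wronskian_comm, gam_inversion hu₀ hz]
  simp only [Fin.isValue, Fin.reduceRev, eigY_zero_one, eigY_one_zero, hconj]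
  field_simp

theorem norm_wronskian_invertColumn (hu₀ : u₀ ≠ 0) (hz : z ≠ 0) (hv : ‖v‖ = u₀)
    (hv' : ‖v'‖ = u₀) :
    ‖wronskian (invertColumn u₀ v j φ (-((u₀ : ℂ) ^ 2 / z)) x)
        (invertColumn u₀ v' j ψ (-((u₀ : ℂ) ^ 2 / z)) x) / gam u₀ (-((u₀ : ℂ) ^ 2 / z))‖
      = ‖wronskian (φ z x) (ψ z x) / gam u₀ z‖ := by
  have hz_norm : ‖z‖ ≠ 0 := norm_ne_zero_iff.2 hz
  have hcoeff {v : ℂ} (hv : ‖v‖ = u₀) :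
      ‖eigY (-((u₀ : ℂ) ^ 2 / z)) v j j.rev‖ = ‖z‖ * ‖u₀‖⁻¹ := by
    subst hv
    fin_cases j <;> simp [eigY_zero_one, eigY_one_zero] <;> field_simp
  simp only [invertColumn_inversion hu₀, wronskian_smul_smul, gam_inversion hu₀ hz,
    norm_div, norm_mul, hcoeff hv, hcoeff hv', norm_pow, norm_real]
  have := norm_ne_zero_iff.2 hu₀
  field_simp

theorem isBigO_inv_inversion (u₀ : ℝ) (F : Filter ℂ) :
    (fun z : ℂ => (-((u₀ : ℂ) ^ 2 / z))⁻¹) =O[F] fun z => z := by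
  refine (Asymptotics.isBigO_const_mul_self (-((u₀ : ℂ) ^ 2)⁻¹) _ F).congr_left fun z => ?_
  rw [inv_neg, inv_div, div_eq_inv_mul, neg_mul]

theorem isBigO_wronskian_of_invertColumn (hu₀ : u₀ ≠ 0) (hv : ‖v‖ = u₀) (hv' : ‖v'‖ = u₀)
    (hF : F ≤ 𝓝[≠] 0)
    (h : (fun z => wronskian (invertColumn u₀ v' 1 ψ z x) (invertColumn u₀ v 0 φ z x) / gam u₀ z
      - c) =O[map (fun z : ℂ => -((u₀ : ℂ) ^ 2 / z)) F] fun z => z⁻¹) :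
    (fun z => wronskian (φ z x) (ψ z x) / gam u₀ z - v' / v * c) =O[F] fun z => z := by
  have hv0 : v ≠ 0 := norm_ne_zero_iff.1 (hv ▸ hu₀)
  have hv'0 : v' ≠ 0 := norm_ne_zero_iff.1 (hv' ▸ hu₀)
  refine (((Asymptotics.isBigO_map.1 h).const_mul_left (v' / v)).congr' ?_ .rfl).trans ?_
  · filter_upwards [hF self_mem_nhdsWithin] with z hz
    simp only [Function.comp_apply, wronskian_invertColumn hu₀ hz hv']
    field_simp
  · exact isBigO_inv_inversion u₀ F

theorem isBigO_wronskian_same_column_of_invertColumn (hu₀ : u₀ ≠ 0) (hv : ‖v‖ = u₀)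
    (hv' : ‖v'‖ = u₀) (hF : F ≤ 𝓝[≠] 0)
    (h : (fun z => wronskian (invertColumn u₀ v j φ z x) (invertColumn u₀ v' j ψ z x) / gam u₀ z)
      =O[map (fun z : ℂ => -((u₀ : ℂ) ^ 2 / z)) F] fun z => z⁻¹) :
    (fun z => wronskian (φ z x) (ψ z x) / gam u₀ z) =O[F] fun z => z := by
  refine (Asymptotics.isBigO_norm_left.1 ?_).trans (isBigO_inv_inversion u₀ F)
  refine (Asymptotics.isBigO_map.1 h).norm_left.congr' ?_ .rfl
  filter_upwards [hF self_mem_nhdsWithin] with z hz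
  exact norm_wronskian_invertColumn hu₀ hz hv hv'

end Inversion

section AsymptoticsAtZero

variable {α u₀ t : ℝ} {um up : ℂ} {u : ℝ → ℝ → ℂ} {F : Filter ℂ} {φ ψ : ℂ → ℝ → Fin 2 → ℂ}

namespace IsProfile

theorem isBigO_wronskian_atTop_zero_atBot_one_of_le_nhdsNE_zero
    (h : IsProfile u₀ um up fun x => u x t) (hα : α ≠ 0)
    (hF : F ≤ 𝓝[≠] 0) (him : ∀ᶠ z in F, (specK α u₀ z * specLam u₀ z).im ≤ 0)
    (hφ : ∀ᶠ z in F, IsJostColumn atTop up α u₀ u 0 t z (φ z))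
    (hψ : ∀ᶠ z in F, IsJostColumn atBot um α u₀ u 1 t z (ψ z)) (x : ℝ) :
    (fun z => wronskian (φ z x) (ψ z x) / gam u₀ z - um / up * exp (I * nu0 α u₀ u t))
      =O[F] fun z => z := by
  have hu₀ := h.pos.ne'
  refine isBigO_wronskian_of_invertColumn hu₀ h.norm_right h.norm_left hF
    (h.isBigO_wronskian_atBot_zero_atTop_one_of_le_cobounded hα
      ((tendsto_inversion_cobounded hu₀).mono_left hF)
      (eventually_map.2 (him.mono fun z hz => ?_))
      (eventually_isJostColumn_invertColumn hu₀ h.norm_left hF hψ :)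
      (eventually_isJostColumn_invertColumn hu₀ h.norm_right hF hφ :) x)
  rwa [im_specK_mul_specLam_inversion hu₀, neg_nonneg]

theorem isBigO_wronskian_atBot_zero_atTop_one_of_le_nhdsNE_zero
    (h : IsProfile u₀ um up fun x => u x t) (hα : α ≠ 0)
    (hF : F ≤ 𝓝[≠] 0) (him : ∀ᶠ z in F, 0 ≤ (specK α u₀ z * specLam u₀ z).im)
    (hφ : ∀ᶠ z in F, IsJostColumn atBot um α u₀ u 0 t z (φ z))
    (hψ : ∀ᶠ z in F, IsJostColumn atTop up α u₀ u 1 t z (ψ z)) (x : ℝ) :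
    (fun z => wronskian (φ z x) (ψ z x) / gam u₀ z - up / um * exp (-(I * nu0 α u₀ u t)))
      =O[F] fun z => z := by
  have hu₀ := h.pos.ne'
  refine isBigO_wronskian_of_invertColumn hu₀ h.norm_left h.norm_right hF
    (h.isBigO_wronskian_atTop_zero_atBot_one_of_le_cobounded hα
      ((tendsto_inversion_cobounded hu₀).mono_left hF)
      (eventually_map.2 (him.mono fun z hz => ?_))
      (eventually_isJostColumn_invertColumn hu₀ h.norm_right hF hψ :)
      (eventually_isJostColumn_invertColumn hu₀ h.norm_left hF hφ :) x)
  rwa [im_specK_mul_specLam_inversion hu₀, neg_nonpos]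

theorem isBigO_wronskian_same_column_of_le_nhdsNE_zero
    (h : IsProfile u₀ um up fun x => u x t) (hα : α ≠ 0)
    (hF : F ≤ 𝓝[≠] 0) (hcontour : ∀ᶠ z in F, z ∈ contour) {j : Fin 2}
    (hφ : ∀ᶠ z in F, IsJostColumn atTop up α u₀ u j t z (φ z))
    (hψ : ∀ᶠ z in F, IsJostColumn atBot um α u₀ u j t z (ψ z)) (x : ℝ) :
    (fun z => wronskian (φ z x) (ψ z x) / gam u₀ z) =O[F] fun z => z := by
  have hu₀ := h.pos.ne'
  exact isBigO_wronskian_same_column_of_invertColumn hu₀ h.norm_right h.norm_left hF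
    (h.isBigO_wronskian_same_column_of_le_cobounded hα
      ((tendsto_inversion_cobounded hu₀).mono_left hF)
      (eventually_map.2 (hcontour.mono fun z hz => inversion_mem_contour hu₀ hz))
      (eventually_isJostColumn_invertColumn hu₀ h.norm_right hF hφ :)
      (eventually_isJostColumn_invertColumn hu₀ h.norm_left hF hψ :) x)

end IsProfile

end AsymptoticsAtZero


/-! ### The scattering matrix -/

section ScatteringMatrix

theorem hasDerivAt_wronskian {A : Matrix (Fin 2) (Fin 2) ℂ} {φ ψ : ℝ → Fin 2 → ℂ} {x : ℝ}
    (hφ : HasDerivAt φ (A *ᵥ φ x) x) (hψ : HasDerivAt ψ (A *ᵥ ψ x) x) :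
    HasDerivAt (fun y => wronskian (φ y) (ψ y)) (A.trace * wronskian (φ x) (ψ x)) x := by
  rw [hasDerivAt_pi] at hφ hψ
  refine (((hφ 0).mul (hψ 1)).sub ((hφ 1).mul (hψ 0))).congr_deriv ?_
  simp only [mulVec, dotProduct, Fin.sum_univ_two, trace_fin_two, wronskian]
  ring

theorem inv_mul_eq_wronskian (M P : Matrix (Fin 2) (Fin 2) ℂ) :
    M⁻¹ * P = !![wronskian (P.col 0) (M.col 1), wronskian (P.col 1) (M.col 1);
      -wronskian (P.col 0) (M.col 0), wronskian (M.col 0) (P.col 1)].map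
        (· / M.det) := by
  rw [Matrix.inv_def, Ring.inverse_eq_inv', adjugate_fin_two, det_fin_two]
  ext i j
  fin_cases i <;> fin_cases j <;> simp [wronskian, mul_apply] <;> ring

variable {α u₀ t : ℝ} {z : ℂ} {l l' : Filter ℝ} {v v' um up : ℂ} {u : ℝ → ℝ → ℂ} {j j' : Fin 2}
  {φ ψ : ℝ → Fin 2 → ℂ}

theorem IsJostColumn.wronskian_eq (hφ : IsJostColumn l v α u₀ u j t z φ)
    (hψ : IsJostColumn l' v' α u₀ u j' t z ψ) (x y : ℝ) :
    wronskian (φ x) (ψ x) = wronskian (φ y) (ψ y) := by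
  have htrace (x : ℝ) : (laxX α u₀ z (u x t)).trace = 0 := by simp [laxX_eq, trace_fin_two]
  have hderiv (x : ℝ) : HasDerivAt (fun y => wronskian (φ y) (ψ y)) 0 x := by
    simpa only [htrace, zero_mul] using hasDerivAt_wronskian (hφ.1 x) (hψ.1 x)
  exact is_const_of_deriv_eq_zero (fun x => (hderiv x).differentiableAt)
    (fun x => (hderiv x).deriv) x y

theorem wronskian_eigY (hv : ‖v‖ = u₀) :
    wronskian (fun i => eigY z v i 0) (fun i => eigY z v i 1) = gam u₀ z := by
  have hvv : v * starRingEnd ℂ v = (u₀ : ℂ) ^ 2 := by rw [mul_conj', hv]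
  rw [wronskian, eigY_apply_self, eigY_apply_self, eigY_zero_one, eigY_one_zero, gam, ← hvv]
  ring

theorem IsJostColumn.wronskian_eq_gam [l.NeBot] (hv : ‖v‖ = u₀)
    (hφ : IsJostColumn l v α u₀ u 0 t z φ) (hψ : IsJostColumn l v α u₀ u 1 t z ψ) (x : ℝ) :
    wronskian (φ x) (ψ x) = gam u₀ z := by
  have hφ_lim := tendsto_pi_nhds.1 hφ.2
  have hψ_lim := tendsto_pi_nhds.1 hψ.2
  have hlim := ((hφ_lim 0).mul (hψ_lim 1)).sub ((hφ_lim 1).mul (hψ_lim 0))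
  rw [← wronskian_eigY hv]
  refine tendsto_nhds_unique (tendsto_const_nhds.congr fun y => ?_) hlim
  exact (hφ.wronskian_eq hψ x y).trans (wronskian_expSigma3_smul _ _ _).symm

theorem IsProfile.isJostColumn_of_mem_contour (h : IsProfile u₀ um up fun x => u x t) (hα : α ≠ 0)
    (hz : z ∈ contour) (hlam : specLam u₀ z ≠ 0) (j : Fin 2) :
    IsJostColumn atBot um α u₀ u j t z (fun x => jostColumn atBot um α u₀ u j x t z) ∧
      IsJostColumn atTop up α u₀ u j t z (fun x => jostColumn atTop up α u₀ u j x t z) := by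
  have him := im_specK_mul_specLam_of_mem_contour (α := α) (u₀ := u₀) hz
  fin_cases j
  · exact ⟨isJostColumn_jostColumn (h.exists_isJostColumn_atBot_zero hα hz.2 hlam him.ge),
      isJostColumn_jostColumn (h.exists_isJostColumn_atTop_zero hα hz.2 hlam him.le)⟩
  · exact ⟨isJostColumn_jostColumn (h.exists_isJostColumn_atBot_one hα hz.2 hlam him.le),
      isJostColumn_jostColumn (h.exists_isJostColumn_atTop_one hα hz.2 hlam him.ge)⟩

theorem IsProfile.det_jost_atBot (h : IsProfile u₀ um up fun x => u x t) (hα : α ≠ 0)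
    (hz : z ∈ contour) (hlam : specLam u₀ z ≠ 0) (x : ℝ) :
    (jost atBot um α u₀ u x t z).det = gam u₀ z := by
  have hcolumn := h.isJostColumn_of_mem_contour hα hz hlam
  rw [det_fin_two, ← (hcolumn 0).1.wronskian_eq_gam h.norm_left (hcolumn 1).1 x, wronskian]
  simp only [jost, of_apply]
  ring

theorem IsProfile.inv_jost_mul_jost (h : IsProfile u₀ um up fun x => u x t) (hα : α ≠ 0)
    (hz : z ∈ contour) (hlam : specLam u₀ z ≠ 0) (x : ℝ) :
    (jost atBot um α u₀ u x t z)⁻¹ * jost atTop up α u₀ u x t z =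
      !![wronskian (jostColumn atTop up α u₀ u 0 x t z) (jostColumn atBot um α u₀ u 1 x t z),
        wronskian (jostColumn atTop up α u₀ u 1 x t z) (jostColumn atBot um α u₀ u 1 x t z);
        -wronskian (jostColumn atTop up α u₀ u 0 x t z) (jostColumn atBot um α u₀ u 0 x t z),
        wronskian (jostColumn atBot um α u₀ u 0 x t z) (jostColumn atTop up α u₀ u 1 x t z)].map
        (· / gam u₀ z) := by
  rw [inv_mul_eq_wronskian, h.det_jost_atBot hα hz hlam x]
  rfl

theorem IsProfile.scatteringMatrix_eq (h : IsProfile u₀ um up fun x => u x t) (hα : α ≠ 0)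
    (hz : z ∈ contour) (hlam : specLam u₀ z ≠ 0) (x : ℝ) :
    scatteringMatrix α u₀ um up u t z =
      (jost atBot um α u₀ u x t z)⁻¹ * jost atTop up α u₀ u x t z := by
  have hdet (y : ℝ) : IsUnit (jost atBot um α u₀ u y t z).det := by
    rw [h.det_jost_atBot hα hz hlam]
    exact (gam_ne_zero hz.2 hlam).isUnit
  have hcolumn := h.isJostColumn_of_mem_contour hα hz hlam
  have hconst (y : ℝ) : (jost atBot um α u₀ u x t z)⁻¹ * jost atTop up α u₀ u x t z
      = (jost atBot um α u₀ u y t z)⁻¹ * jost atTop up α u₀ u y t z := by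
    rw [h.inv_jost_mul_jost hα hz hlam, h.inv_jost_mul_jost hα hz hlam,
      (hcolumn 0).2.wronskian_eq (hcolumn 1).1 x y, (hcolumn 1).2.wronskian_eq (hcolumn 1).1 x y,
      (hcolumn 0).2.wronskian_eq (hcolumn 0).1 x y, (hcolumn 0).1.wronskian_eq (hcolumn 1).2 x y]
  have hex : ∃ S, ∀ y, jost atTop up α u₀ u y t z = jost atBot um α u₀ u y t z * S :=
    ⟨(jost atBot um α u₀ u x t z)⁻¹ * jost atTop up α u₀ u x t z, fun y => by
      rw [hconst y, mul_nonsing_inv_cancel_left _ _ (hdet y)]⟩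
  rw [scatteringMatrix, dif_pos hex, hex.choose_spec x, nonsing_inv_mul_cancel_left _ _ (hdet x)]

end ScatteringMatrix


section Regions

variable {α u₀ : ℝ} {z : ℂ}

theorem zero_notMem_Dplus_union_contour : (0 : ℂ) ∉ Dplus ∪ contour := by
  simp [Dplus, contour]

theorem zero_notMem_Dminus_union_contour : (0 : ℂ) ∉ Dminus ∪ contour := by
  simp [Dminus, contour]

theorem im_specK_mul_specLam_nonpos (hα : 0 < α) (hz : z ∈ Dplus ∪ contour) :
    (specK α u₀ z * specLam u₀ z).im ≤ 0 := by
  have hz0 : z ≠ 0 := fun h => zero_notMem_Dplus_union_contour (h ▸ hz)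
  rw [im_specK_mul_specLam hz0]
  exact mul_nonpos_of_nonpos_of_nonneg (hz.elim (fun h => le_of_lt h) fun h => h.1.le)
    (by positivity)

theorem im_specK_mul_specLam_nonneg (hα : 0 < α) (hz : z ∈ Dminus ∪ contour) :
    0 ≤ (specK α u₀ z * specLam u₀ z).im := by
  have hz0 : z ≠ 0 := fun h => zero_notMem_Dminus_union_contour (h ▸ hz)
  rw [im_specK_mul_specLam hz0]
  exact mul_nonneg (hz.elim (fun h => le_of_lt h) fun h => h.1.ge) (by positivity)

theorem nhdsWithin_le_nhdsNE {S : Set ℂ} (hS : (0 : ℂ) ∉ S) : 𝓝[S] (0 : ℂ) ≤ 𝓝[≠] 0 :=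
  nhdsWithin_mono _ fun _ hz => ne_of_mem_of_not_mem hz hS

end Regions

section ScatteringAsymptotics

variable {α u₀ t : ℝ} {um up : ℂ} {u : ℝ → ℝ → ℂ} {F : Filter ℂ}

theorem eventually_isJostColumn_jostColumn {l : Filter ℝ} {v : ℂ} {j : Fin 2} {p : ℂ → Prop}
    (hF : F ≤ cofinite) (hp : ∀ᶠ z in F, p z)
    (hex : ∀ z, z ≠ 0 → specLam u₀ z ≠ 0 → p z → ∃ φ, IsJostColumn l v α u₀ u j t z φ) :
    ∀ᶠ z in F, IsJostColumn l v α u₀ u j t z fun x => jostColumn l v α u₀ u j x t z := by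
  filter_upwards [hp, hF (eventually_cofinite_specLam_ne_zero u₀)] with z hpz hz
  exact isJostColumn_jostColumn (hex z hz.1 hz.2 hpz)

namespace IsProfile

theorem isBigO_s11_cobounded (h : IsProfile u₀ um up fun x => u x t) (hα : 0 < α) (x : ℝ) :
    (fun z => s11 α u₀ um up u x t z - exp (-(I * nu0 α u₀ u t)))
      =O[Bornology.cobounded ℂ ⊓ 𝓟 (Dplus ∪ contour)] fun z => z⁻¹ := by
  have hF : Bornology.cobounded ℂ ⊓ 𝓟 (Dplus ∪ contour) ≤ cofinite :=
    inf_le_left.trans (Bornology.le_cofinite ℂ)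
  have him : ∀ᶠ z in Bornology.cobounded ℂ ⊓ 𝓟 (Dplus ∪ contour), _ :=
    eventually_inf_principal.2 (Eventually.of_forall fun z =>
      im_specK_mul_specLam_nonpos (u₀ := u₀) hα)
  exact h.isBigO_wronskian_atTop_zero_atBot_one_of_le_cobounded hα.ne' inf_le_left him
    (eventually_isJostColumn_jostColumn hF him fun z =>
      h.exists_isJostColumn_atTop_zero hα.ne')
    (eventually_isJostColumn_jostColumn hF him fun z =>
      h.exists_isJostColumn_atBot_one hα.ne') x

theorem isBigO_s22_cobounded (h : IsProfile u₀ um up fun x => u x t) (hα : 0 < α) (x : ℝ) :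
    (fun z => s22 α u₀ um up u x t z - exp (I * nu0 α u₀ u t))
      =O[Bornology.cobounded ℂ ⊓ 𝓟 (Dminus ∪ contour)] fun z => z⁻¹ := by
  have hF : Bornology.cobounded ℂ ⊓ 𝓟 (Dminus ∪ contour) ≤ cofinite :=
    inf_le_left.trans (Bornology.le_cofinite ℂ)
  have him : ∀ᶠ z in Bornology.cobounded ℂ ⊓ 𝓟 (Dminus ∪ contour), _ :=
    eventually_inf_principal.2 (Eventually.of_forall fun z =>
      im_specK_mul_specLam_nonneg (u₀ := u₀) hα)
  exact h.isBigO_wronskian_atBot_zero_atTop_one_of_le_cobounded hα.ne' inf_le_left him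
    (eventually_isJostColumn_jostColumn hF him fun z =>
      h.exists_isJostColumn_atBot_zero hα.ne')
    (eventually_isJostColumn_jostColumn hF him fun z =>
      h.exists_isJostColumn_atTop_one hα.ne') x

theorem isBigO_s11_zero (h : IsProfile u₀ um up fun x => u x t) (hα : 0 < α) (x : ℝ) :
    (fun z => s11 α u₀ um up u x t z - um / up * exp (I * nu0 α u₀ u t))
      =O[𝓝[Dplus ∪ contour] 0] fun z => z := by
  have hF : 𝓝[Dplus ∪ contour] (0 : ℂ) ≤ 𝓝[≠] 0 :=
    nhdsWithin_le_nhdsNE zero_notMem_Dplus_union_contour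
  have him : ∀ᶠ z in 𝓝[Dplus ∪ contour] (0 : ℂ), _ :=
    eventually_nhdsWithin_of_forall fun z => im_specK_mul_specLam_nonpos (u₀ := u₀) hα
  exact h.isBigO_wronskian_atTop_zero_atBot_one_of_le_nhdsNE_zero hα.ne' hF him
    (eventually_isJostColumn_jostColumn (hF.trans (nhdsNE_le_cofinite 0)) him fun z =>
      h.exists_isJostColumn_atTop_zero hα.ne')
    (eventually_isJostColumn_jostColumn (hF.trans (nhdsNE_le_cofinite 0)) him fun z =>
      h.exists_isJostColumn_atBot_one hα.ne') x

theorem isBigO_s22_zero (h : IsProfile u₀ um up fun x => u x t) (hα : 0 < α) (x : ℝ) :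
    (fun z => s22 α u₀ um up u x t z - up / um * exp (-(I * nu0 α u₀ u t)))
      =O[𝓝[Dminus ∪ contour] 0] fun z => z := by
  have hF : 𝓝[Dminus ∪ contour] (0 : ℂ) ≤ 𝓝[≠] 0 :=
    nhdsWithin_le_nhdsNE zero_notMem_Dminus_union_contour
  have him : ∀ᶠ z in 𝓝[Dminus ∪ contour] (0 : ℂ), _ :=
    eventually_nhdsWithin_of_forall fun z => im_specK_mul_specLam_nonneg (u₀ := u₀) hα
  exact h.isBigO_wronskian_atBot_zero_atTop_one_of_le_nhdsNE_zero hα.ne' hF him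
    (eventually_isJostColumn_jostColumn (hF.trans (nhdsNE_le_cofinite 0)) him fun z =>
      h.exists_isJostColumn_atBot_zero hα.ne')
    (eventually_isJostColumn_jostColumn (hF.trans (nhdsNE_le_cofinite 0)) him fun z =>
      h.exists_isJostColumn_atTop_one hα.ne') x

theorem eventually_scatteringMatrix_eq (h : IsProfile u₀ um up fun x => u x t) (hα : α ≠ 0)
    (hF : F ≤ cofinite) (hcontour : ∀ᶠ z in F, z ∈ contour) (x : ℝ) :
    ∀ᶠ z in F, scatteringMatrix α u₀ um up u t z =
      !![s11 α u₀ um up u x t z,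
        wronskian (jostColumn atTop up α u₀ u 1 x t z) (jostColumn atBot um α u₀ u 1 x t z)
          / gam u₀ z;
        -wronskian (jostColumn atTop up α u₀ u 0 x t z) (jostColumn atBot um α u₀ u 0 x t z)
          / gam u₀ z, s22 α u₀ um up u x t z] := by
  filter_upwards [hcontour, hF (eventually_cofinite_specLam_ne_zero u₀)] with z hz hlam
  rw [h.scatteringMatrix_eq hα hz hlam.2 x, h.inv_jost_mul_jost hα hz hlam.2 x]
  ext i j
  fin_cases i <;> fin_cases j <;> rfl

theorem eventually_isJostColumn_of_mem_contour (h : IsProfile u₀ um up fun x => u x t) (hα : α ≠ 0)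
    (hF : F ≤ cofinite) (hcontour : ∀ᶠ z in F, z ∈ contour) (j : Fin 2) :
    (∀ᶠ z in F, IsJostColumn atTop up α u₀ u j t z fun x => jostColumn atTop up α u₀ u j x t z) ∧
      ∀ᶠ z in F, IsJostColumn atBot um α u₀ u j t z fun x =>
        jostColumn atBot um α u₀ u j x t z := by
  rw [← eventually_and]
  filter_upwards [hcontour, hF (eventually_cofinite_specLam_ne_zero u₀)] with z hz hlam
  exact (h.isJostColumn_of_mem_contour hα hz hlam.2 j).symm

theorem isBigO_scatteringMatrix_cobounded (h : IsProfile u₀ um up fun x => u x t) (hα : 0 < α)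
    (i j : Fin 2) :
    (fun z => (scatteringMatrix α u₀ um up u t z - expSigma3 (-(I * nu0 α u₀ u t))) i j)
      =O[Bornology.cobounded ℂ ⊓ 𝓟 contour] fun z => z⁻¹ := by
  have hF : Bornology.cobounded ℂ ⊓ 𝓟 contour ≤ cofinite :=
    inf_le_left.trans (Bornology.le_cofinite ℂ)
  have hmono (D : Set ℂ) :
      Bornology.cobounded ℂ ⊓ 𝓟 contour ≤ Bornology.cobounded ℂ ⊓ 𝓟 (D ∪ contour) :=
    inf_le_inf_left _ (principal_mono.2 Set.subset_union_right)
  have hcontour : ∀ᶠ z in Bornology.cobounded ℂ ⊓ 𝓟 contour, z ∈ contour :=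
    mem_inf_of_right (mem_principal_self _)
  have hsame (j : Fin 2) := h.isBigO_wronskian_same_column_of_le_cobounded hα.ne' inf_le_left
    hcontour (h.eventually_isJostColumn_of_mem_contour hα.ne' hF hcontour j).1
    (h.eventually_isJostColumn_of_mem_contour hα.ne' hF hcontour j).2 0
  have hentries := h.eventually_scatteringMatrix_eq hα.ne' hF hcontour 0
  fin_cases i <;> fin_cases j
  · refine ((h.isBigO_s11_cobounded hα 0).mono (hmono _)).congr' ?_ .rfl
    filter_upwards [hentries] with z hz
    simp [hz, expSigma3]
  · refine (hsame 1).congr' ?_ .rfl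
    filter_upwards [hentries] with z hz
    simp [hz, expSigma3]
  · refine (hsame 0).neg_left.congr' ?_ .rfl
    filter_upwards [hentries] with z hz
    simp [hz, expSigma3, neg_div]
  · refine ((h.isBigO_s22_cobounded hα 0).mono (hmono _)).congr' ?_ .rfl
    filter_upwards [hentries] with z hz
    simp [hz, expSigma3]

theorem isBigO_scatteringMatrix_zero (h : IsProfile u₀ um up fun x => u x t) (hα : 0 < α)
    (i j : Fin 2) :
    (fun z => (scatteringMatrix α u₀ um up u t z
      - !![um / up, 0; 0, up / um] * expSigma3 (I * nu0 α u₀ u t)) i j)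
      =O[𝓝[contour] 0] fun z => z := by
  have hF : 𝓝[contour] (0 : ℂ) ≤ 𝓝[≠] 0 := nhdsWithin_le_nhdsNE fun h0 => h0.2 rfl
  have hcofinite := hF.trans (nhdsNE_le_cofinite 0)
  have hmono (D : Set ℂ) : 𝓝[contour] (0 : ℂ) ≤ 𝓝[D ∪ contour] 0 :=
    nhdsWithin_mono _ Set.subset_union_right
  have hsame (j : Fin 2) := h.isBigO_wronskian_same_column_of_le_nhdsNE_zero hα.ne' hF
    self_mem_nhdsWithin
    (h.eventually_isJostColumn_of_mem_contour hα.ne' hcofinite self_mem_nhdsWithin j).1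
    (h.eventually_isJostColumn_of_mem_contour hα.ne' hcofinite self_mem_nhdsWithin j).2 0
  have hentries := h.eventually_scatteringMatrix_eq hα.ne' hcofinite self_mem_nhdsWithin 0
  fin_cases i <;> fin_cases j
  · refine ((h.isBigO_s11_zero hα 0).mono (hmono _)).congr' ?_ .rfl
    filter_upwards [hentries] with z hz
    simp [hz, expSigma3]
  · refine (hsame 1).congr' ?_ .rfl
    filter_upwards [hentries] with z hz
    simp [hz, expSigma3]
  · refine (hsame 0).neg_left.congr' ?_ .rfl
    filter_upwards [hentries] with z hz
    simp [hz, expSigma3, neg_div]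
  · refine ((h.isBigO_s22_zero hα 0).mono (hmono _)).congr' ?_ .rfl
    filter_upwards [hentries] with z hz
    simp [hz, expSigma3]

end IsProfile

end ScatteringAsymptotics

end MNLS

theorem mainTheorem6 (α u₀ : ℝ) (hα : 0 < α) (hu₀ : 0 < u₀) (um up : ℂ)
    (hum : ‖um‖ = u₀) (hup : ‖up‖ = u₀) (u : ℝ → ℝ → ℂ) (t : ℝ)
    (hsmooth : ContDiff ℝ 1 (fun x => u x t))
    (hlim_m : Tendsto (fun x => u x t) atBot (𝓝 um))
    (hlim_p : Tendsto (fun x => u x t) atTop (𝓝 up))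
    (hint_m : IntegrableOn (fun x => u x t - um) (Set.Iic 0))
    (hint_p : IntegrableOn (fun x => u x t - up) (Set.Ici 0))
    (hint_x : Integrable (deriv fun x => u x t)) :
    -- the integral that defines `ν₀` converges absolutely
    Integrable (fun y : ℝ => u₀ ^ 2 - ‖u y t‖ ^ 2) ∧
    -- the scattering matrix on `Σ`, as `z → ∞` and as `z → 0`
    (∀ i j : Fin 2,
      (fun z => (MNLS.scatteringMatrix α u₀ um up u t z
          - MNLS.expSigma3 (-(I * (MNLS.nu0 α u₀ u t : ℂ)))) i j)
        =O[Bornology.cobounded ℂ ⊓ 𝓟 MNLS.contour] fun z => z⁻¹) ∧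
    (∀ i j : Fin 2,
      (fun z => (MNLS.scatteringMatrix α u₀ um up u t z
          - !![um / up, 0; 0, up / um] * MNLS.expSigma3 (I * (MNLS.nu0 α u₀ u t : ℂ))) i j)
        =O[𝓝[MNLS.contour] 0] fun z => z) ∧
    -- on `Σ` the diagonal entries are the Wronskian quotients `s₁₁`, `s₂₂`
    (∀ x : ℝ, ∀ z ∈ MNLS.contour, z ≠ I * (u₀ : ℂ) → z ≠ -(I * (u₀ : ℂ)) →
      MNLS.scatteringMatrix α u₀ um up u t z 0 0 = MNLS.s11 α u₀ um up u x t z ∧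
      MNLS.scatteringMatrix α u₀ um up u t z 1 1 = MNLS.s22 α u₀ um up u x t z) ∧
    -- the diagonal entries on the full regions where they are defined
    (∀ x : ℝ,
      ((fun z => MNLS.s11 α u₀ um up u x t z - exp (-(I * (MNLS.nu0 α u₀ u t : ℂ))))
        =O[Bornology.cobounded ℂ ⊓ 𝓟 (MNLS.Dplus ∪ MNLS.contour)] fun z => z⁻¹) ∧
      ((fun z => MNLS.s22 α u₀ um up u x t z - exp (I * (MNLS.nu0 α u₀ u t : ℂ)))
        =O[Bornology.cobounded ℂ ⊓ 𝓟 (MNLS.Dminus ∪ MNLS.contour)] fun z => z⁻¹) ∧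
      ((fun z => MNLS.s11 α u₀ um up u x t z
          - um / up * exp (I * (MNLS.nu0 α u₀ u t : ℂ)))
        =O[𝓝[MNLS.Dplus ∪ MNLS.contour] 0] fun z => z) ∧
      ((fun z => MNLS.s22 α u₀ um up u x t z
          - up / um * exp (-(I * (MNLS.nu0 α u₀ u t : ℂ))))
        =O[𝓝[MNLS.Dminus ∪ MNLS.contour] 0] fun z => z)) := by
  have h : MNLS.IsProfile u₀ um up fun x => u x t :=
    ⟨hu₀, hum, hup, hsmooth, hlim_m, hlim_p, hint_m, hint_p, hint_x⟩
  refine ⟨h.integrable_sq_sub_norm_sq, h.isBigO_scatteringMatrix_cobounded hα,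
    h.isBigO_scatteringMatrix_zero hα, fun x z hz hpos hneg => ?_, fun x =>
      ⟨h.isBigO_s11_cobounded hα x, h.isBigO_s22_cobounded hα x, h.isBigO_s11_zero hα x,
        h.isBigO_s22_zero hα x⟩⟩
  have hlam := MNLS.specLam_ne_zero hz.2 hpos hneg
  rw [h.scatteringMatrix_eq hα.ne' hz hlam x, h.inv_jost_mul_jost hα.ne' hz hlam x]
  exact ⟨rfl, rfl⟩
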